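/- Let $\mathbb{H}$ be the real algebra of quaternions with its Euclidean norm, let $\mathbb{S}=\{I\in\mathbb{H}: \operatorname{Re} I=0,\ |I|=1\}$ be the sphere of imaginary units and, for $I\in\mathbb{S}$, let $\mathbb{C}_I=\{x+Iy: x,y\in\mathbb{R}\}$. A set $U\subseteq\mathbb{H}$ is axially symmetric if $x+Iy\in U$ with $x,y\in\mathbb{R}$, $I\in\mathbb{S}$ implies $x+Jy\in U$ for all $J\in\mathbb{S}$. Let $\mathfrak{R}(\mathbb{H})$ be the class of axially symmetric open sets $\Omega\subseteq\mathbb{H}$ such that $\Omega\cap\mathbb{C}_I$ is simply connected for every $I\in\mathbb{S}$. A function $f:U\to\mathbb{H}$ on an open set $U$ is slice regular if it is real differentiable and, for every $I\in\mathbb{S}$, $\frac12\left(\frac{\partial}{\partial x}+I\frac{\partial}{\partial y}\right)f(x+Iy)=0$ at all points $x+Iy\in U$; it is quaternionic intrinsic if moreover $f(U\cap\mathbb{C}_I)\subseteq\mathbb{C}_I$ for every $I\in\mathbb{S}$. The slice derivative $f'$ is $f'(x+Iy)=\frac12\left(\frac{\partial}{\partial x}-I\frac{\partial}{\partial y}\right)f(x+Iy)$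 for $y\neq0$ and $f'(x)=\frac{\partial f}{\partial x}(x)$ for $x\in\mathbb{R}$. Let $\Omega\in\mathfrak{R}(\mathbb{H})$ with $\Omega\neq\mathbb{H}$, let $\mathbb{B}\subset\mathbb{H}$ be the open unit ball, and let $x_0\in\Omega\cap\mathbb{R}$. Then there exists a unique bijective quaternionic intrinsic slice regular function $f:\Omega\to\mathbb{B}$ such that $f(x_0)=0$ and $f'(x_0)>0$ (that is, $f'(x_0)$ is a positive real number). Moreover, for every $J\in\mathbb{S}$, writing $\Omega_J=\{x+iy\in\mathbb{C}: x+Jy\in\Omega\}$, the set $\Omega_J$ is symmetric with respect to the real axis and there is a holomorphic bijection $\varphi$ from $\Omega_J$ onto the open unit disc with $\varphi(x_0)=0$, $\varphi'(x_0)>0$ and $\varphi(\bar z)=\overline{\varphi(z)}$ for all $z\in\Omega_J$ such that, with $F(x+Jy)=\operatorname{Re}\varphi(x+iy)+J\operatorname{Im}\varphi(x+iy)$, $$f(x+Iy)=\frac12\big[F(x+Jy)+F(x-Jy)\big]+I\,\frac12\Big[J\big(F(x-Jy)-F(x+Jy)\big)\Big]$$ for all $I\in\mathbb{S}$ and $x,y\in\mathbb{R}$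 with $x+Iy\in\Omega$. -/

import Mathlib

open scoped Quaternion

namespace SliceRiemann

/-- The sphere of imaginary units: purely imaginary quaternions of norm one. -/
def imagSphere : Set ℍ[ℝ] := {I | I.re = 0 ∧ ‖I‖ = 1}

/-- The quaternion `x + I y`. -/
noncomputable def slicePoint (I : ℍ[ℝ]) (x y : ℝ) : ℍ[ℝ] := (x : ℍ[ℝ]) + I * (y : ℍ[ℝ])

/-- The complex plane `ℂ_I = {x + I y : x, y ∈ ℝ}`. -/
def slicePlane (I : ℍ[ℝ]) : Set ℍ[ℝ] := {q | ∃ x y : ℝ, q = slicePoint I x y}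

/-- The Cauchy-Riemann operator `(1/2)(∂/∂x + I ∂/∂y)` applied to the restriction of `f` to `ℂ_I`,
at the point `x + I y`. -/
noncomputable def dbar (I : ℍ[ℝ]) (f : ℍ[ℝ] → ℍ[ℝ]) (x y : ℝ) : ℍ[ℝ] :=
  (1 / 2 : ℝ) • (deriv (fun s : ℝ => f (slicePoint I s y)) x
    + I * deriv (fun t : ℝ => f (slicePoint I x t)) y)

/-- The operator `(1/2)(∂/∂x - I ∂/∂y)` applied to the restriction of `f` to `ℂ_I`,
at the point `x + I y`. -/
noncomputable def dslice (I : ℍ[ℝ]) (f : ℍ[ℝ] → ℍ[ℝ]) (x y : ℝ) : ℍ[ℝ] :=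
  (1 / 2 : ℝ) • (deriv (fun s : ℝ => f (slicePoint I s y)) x
    - I * deriv (fun t : ℝ => f (slicePoint I x t)) y)

/-- `f` is slice regular on the open set `U`: real differentiable, and annihilated by the
Cauchy-Riemann operator on every slice. Only the values of `f` on `U` matter, as `U` is open. -/
structure SliceRegularOn (f : ℍ[ℝ] → ℍ[ℝ]) (U : Set ℍ[ℝ]) : Prop where
  isOpen : IsOpen U
  differentiableOn : DifferentiableOn ℝ f U
  dbar_eq_zero : ∀ I ∈ imagSphere, ∀ x y : ℝ, slicePoint I x y ∈ U → dbar I f x y = 0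

open Classical in
/-- The slice derivative: `∂f/∂x` at real points; at a non-real point `q = x + I y`, with
`I = im q / ‖im q‖`, `x = re q` and `y = ‖im q‖`, it is `(1/2)(∂/∂x - I ∂/∂y) f_I (x + I y)`. -/
noncomputable def sliceDeriv (f : ℍ[ℝ] → ℍ[ℝ]) (q : ℍ[ℝ]) : ℍ[ℝ] :=
  if q.im = 0 then deriv (fun s : ℝ => f (s : ℍ[ℝ])) q.re
  else dslice (‖q.im‖⁻¹ • q.im) f q.re ‖q.im‖

/-- The class of quaternionic intrinsic functions on `U`: slice regular functions on `U` mapping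
`U ∩ ℂ_I` into `ℂ_I` for every imaginary unit `I`. -/
structure QuaternionicIntrinsicOn (f : ℍ[ℝ] → ℍ[ℝ]) (U : Set ℍ[ℝ]) : Prop where
  sliceRegularOn : SliceRegularOn f U
  mapsTo : ∀ I ∈ imagSphere, Set.MapsTo f (U ∩ slicePlane I) (slicePlane I)

/-- `U` is axially symmetric: with `x + I y` it contains every `x + J y`. -/
def AxiallySymmetric (U : Set ℍ[ℝ]) : Prop :=
  ∀ I ∈ imagSphere, ∀ x y : ℝ, slicePoint I x y ∈ U → ∀ J ∈ imagSphere, slicePoint J x y ∈ U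

/-- The class of axially symmetric open sets all of whose slices are simply connected. -/
structure AxialSimplyConnected (U : Set ℍ[ℝ]) : Prop where
  isOpen : IsOpen U
  axiallySymmetric : AxiallySymmetric U
  isSimplyConnected : ∀ I ∈ imagSphere, IsSimplyConnected (U ∩ slicePlane I)

/-- `f` restricts to a bijection of `U` onto the open unit ball, is quaternionic intrinsic on `U`,
and satisfies `f x₀ = 0`, `f' x₀ > 0` (the slice derivative is a positive real). -/
structure IsNormalizedRiemannMap (f : ℍ[ℝ] → ℍ[ℝ]) (U : Set ℍ[ℝ]) (x₀ : ℝ) : Prop where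
  intrinsic : QuaternionicIntrinsicOn f U
  bijOn : Set.BijOn f U (Metric.ball 0 1)
  map_base : f (x₀ : ℍ[ℝ]) = 0
  sliceDeriv_pos : ∃ c : ℝ, 0 < c ∧ sliceDeriv f (x₀ : ℍ[ℝ]) = (c : ℍ[ℝ])

/-- The slice `U ∩ ℂ_J` read in `ℂ` through `x + i y ↦ x + J y`. -/
def complexSlice (J : ℍ[ℝ]) (U : Set ℍ[ℝ]) : Set ℂ := {z | slicePoint J z.re z.im ∈ U}

/-- `φ` is a holomorphic bijection of `G` onto the unit disc with `φ x₀ = 0`, `φ' x₀ > 0`,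
which is (complex) intrinsic: `G` is invariant under conjugation and `φ (conj z) = conj (φ z)`. -/
structure IsIntrinsicRiemannMap (φ : ℂ → ℂ) (G : Set ℂ) (x₀ : ℝ) : Prop where
  differentiableOn : DifferentiableOn ℂ φ G
  bijOn : Set.BijOn φ G (Metric.ball 0 1)
  map_base : φ (x₀ : ℂ) = 0
  deriv_pos : ∃ c : ℝ, 0 < c ∧ deriv φ (x₀ : ℂ) = (c : ℂ)
  conj_mem : ∀ z ∈ G, (starRingEnd ℂ) z ∈ G
  map_conj : ∀ z ∈ G, φ ((starRingEnd ℂ) z) = (starRingEnd ℂ) (φ z)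

/-- The function `x + J y ↦ φ (x + i y)`, read in `ℂ_J`, in the real coordinates `x, y`. -/
noncomputable def onSlice (J : ℍ[ℝ]) (φ : ℂ → ℂ) (x y : ℝ) : ℍ[ℝ] :=
  slicePoint J (φ ⟨x, y⟩).re (φ ⟨x, y⟩).im

/-- The extension formula: the value at `x + I y` of the extension of a function given on `ℂ_J`
by `F x y` at `x + J y`. -/
noncomputable def sliceExt (J : ℍ[ℝ]) (F : ℝ → ℝ → ℍ[ℝ]) (I : ℍ[ℝ]) (x y : ℝ) : ℍ[ℝ] :=
  (1 / 2 : ℝ) • (F x y + F x (-y)) + I * ((1 / 2 : ℝ) • (J * (F x (-y) - F x y)))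

end SliceRiemann

namespace SliceRiemann

/-! By axial symmetry every slice of Ω gives the same set G in ℂ, and G is invariant under
conjugation. Since Ω meets the real axis and G is connected, an intrinsic slice regular function on
Ω is one holomorphic φ on G with φ(z̄) = conj φ(z), copied into every slice; conversely the Riemann
map of G, having this symmetry, lifts by Re φ + I Im φ. Bijectivity and normalization pass through
this correspondence, so everything reduces to the Riemann mapping theorem on G.

That theorem is proved by the extremal method: Montel (`isCompact_boundedHolomorphic`) supplies a
maximizer of |g'(x₀)|, Hurwitz (`injOn_of_tendstoLocallyUniformlyOn`) keeps it injective, Koebe's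
trick (`exists_norm_deriv_lt`) forces surjectivity. The Schwarz lemma gives uniqueness, and
uniqueness applied to conj ∘ φ ∘ conj gives the symmetry of φ.

Two points are quaternionic: differentiability of the lift at real points, where ‖im q‖ is not
smooth (`hasFDerivAt_intrinsicLift_coe`), and the independence of φ from the slice
(`QuaternionicIntrinsicOn.apply_sliceMap`). -/

open Filter Topology Set Metric ComplexConjugate Asymptotics

/-! ### Injective holomorphic functions and Hurwitz's theorem -/

/-- An injective holomorphic function has nowhere vanishing derivative. -/
theorem deriv_ne_zero_of_injOn {f : ℂ → ℂ} {U : Set ℂ} (hU : IsOpen U)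
    (hf : DifferentiableOn ℂ f U) (hinj : InjOn f U) {a : ℂ} (ha : a ∈ U) : deriv f a ≠ 0 := by
  have haU : U ∈ 𝓝 a := hU.mem_nhds ha
  have han : AnalyticAt ℂ (fun z => f z - f a) a := (hf.analyticAt haU).sub analyticAt_const
  have hnc : ¬ ∀ᶠ z in 𝓝 a, f z - f a = 0 := by
    intro h
    have h1 : ∀ᶠ z in 𝓝[≠] a, f z - f a = 0 ∧ z ∈ U := nhdsWithin_le_nhds (h.and haU)
    obtain ⟨z, ⟨hz, hzU⟩, hza⟩ := (h1.and self_mem_nhdsWithin).exists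
    exact hza (hinj hzU ha (sub_eq_zero.1 hz))
  obtain ⟨n, g, hg, hga, hfg⟩ := han.exists_eventuallyEq_pow_smul_nonzero_iff.2 hnc
  have hn0 : n ≠ 0 := by
    rintro rfl
    have := hfg.self_of_nhds
    simp at this
    exact hga this.symm
  obtain ⟨c, hc⟩ := IsAlgClosed.exists_pow_nat_eq (g a) (Nat.pos_of_ne_zero hn0)
  have hc0 : c ≠ 0 := by
    rintro rfl
    exact hga (by rw [← hc, zero_pow hn0])
  -- An n-th root of f - f a. Dividing `g z` by `g a` keeps the base of the power near 1, inside the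
  -- domain of analyticity of `cpow`.
  let k : ℂ → ℂ := fun z => (z - a) * (c * (g z / g a) ^ ((n : ℂ)⁻¹))
  have hrat : AnalyticAt ℂ (fun z => (g z / g a) ^ ((n : ℂ)⁻¹)) a :=
    (hg.div analyticAt_const hga).cpow analyticAt_const (by simp [div_self hga])
  have hk : AnalyticAt ℂ k a :=
    (analyticAt_id.sub analyticAt_const).mul (analyticAt_const.mul hrat)
  have hkd : HasStrictDerivAt k c a := by
    have h1 : HasDerivAt k (1 * (c * (g a / g a) ^ ((n : ℂ)⁻¹)) +
        (a - a) * deriv (fun z => c * (g z / g a) ^ ((n : ℂ)⁻¹)) a) a :=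
      ((hasDerivAt_id a).sub_const a).mul
        (analyticAt_const.mul hrat).differentiableAt.hasDerivAt
    have h2 := hk.hasStrictDerivAt
    rwa [h1.deriv, div_self hga, Complex.one_cpow, sub_self, zero_mul, one_mul, mul_one,
      add_zero] at h2
  have hkn : ∀ᶠ z in 𝓝 a, f z - f a = k z ^ n := by
    filter_upwards [hfg] with z hz
    rw [hz]
    simp only [k, mul_pow, smul_eq_mul, ← Complex.cpow_mul_nat, inv_mul_cancel₀
      (Nat.cast_ne_zero.2 hn0 : (n : ℂ) ≠ 0), Complex.cpow_one, hc]
    rw [mul_div_cancel₀ _ hga]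
  have hn1 : n = 1 := by
    by_contra hn1
    have hζ := Complex.isPrimitiveRoot_exp n hn0
    set ζ := Complex.exp (2 * Real.pi * Complex.I / n)
    -- `k` is open at `a`, so it takes both values w and ζw for some small w ≠ 0; their n-th powers
    -- agree, against injectivity of f.
    have hV : k '' {z | z ∈ U ∧ f z - f a = k z ^ n} ∈ 𝓝 (0 : ℂ) := by
      have : k a = 0 := by simp [k]
      rw [← this, ← hkd.map_nhds_eq hc0]
      exact image_mem_map (inter_mem haU hkn)
    have hV' : ∀ᶠ w in 𝓝 (0 : ℂ), ζ * w ∈ k '' {z | z ∈ U ∧ f z - f a = k z ^ n} := by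
      have : Tendsto (fun w => ζ * w) (𝓝 0) (𝓝 0) := by
        simpa using (continuous_const_mul ζ).tendsto (0 : ℂ)
      exact this hV
    obtain ⟨w, ⟨⟨z₁, ⟨hz₁, e₁⟩, h₁⟩, ⟨z₂, ⟨hz₂, e₂⟩, h₂⟩⟩, hw⟩ :=
      (((eventually_mem_set.2 hV).and hV').filter_mono nhdsWithin_le_nhds |>.and
        (self_mem_nhdsWithin (s := {0}ᶜ))).exists
    have : z₁ = z₂ := by
      apply hinj hz₁ hz₂
      have : f z₁ - f a = f z₂ - f a := by
        rw [e₁, e₂, h₁, h₂, mul_pow, hζ.pow_eq_one, one_mul]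
      exact sub_left_injective this
    have h3 : ζ * w = 1 * w := by rw [← h₂, ← this, h₁, one_mul]
    have h4 : ζ = 1 := mul_right_cancel₀ hw h3
    exact hn1 (by simpa [h4] using hζ.eq_orderOf)
  have hk1 : f =ᶠ[𝓝 a] fun z => k z + f a := by
    filter_upwards [hkn] with z hz
    rw [hn1, pow_one] at hz
    rw [← hz, sub_add_cancel]
  rw [hk1.deriv_eq, deriv_add_const, hkd.hasDerivAt.deriv]
  exact hc0

/-- The inverse of an injective holomorphic function is holomorphic. -/
theorem differentiableOn_invFunOn {f : ℂ → ℂ} {U V : Set ℂ} (hU : IsOpen U)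
    (hf : DifferentiableOn ℂ f U) (hbij : BijOn f U V) :
    DifferentiableOn ℂ (Function.invFunOn f U) V := by
  intro w hw
  obtain ⟨z, hz, rfl⟩ := hbij.surjOn hw
  have hd : HasStrictDerivAt f (deriv f z) z := (hf.analyticAt (hU.mem_nhds hz)).hasStrictDerivAt
  have h0 := deriv_ne_zero_of_injOn hU hf hbij.injOn hz
  have hleft : ∀ᶠ x in 𝓝 z, Function.invFunOn f U (f x) = x := by
    filter_upwards [hU.mem_nhds hz] with x hx
    exact hbij.injOn.leftInvOn_invFunOn hx
  exact (HasStrictDerivAt.hasDerivAt (hd.to_local_left_inverse h0 hleft)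
    ).differentiableAt.differentiableWithinAt

/-- A locally uniform limit of injective holomorphic functions on a connected open set is injective,
unless its derivative vanishes identically. -/
theorem injOn_of_tendstoLocallyUniformlyOn {ι : Type*} {l : Filter ι} [l.NeBot] {F : ι → ℂ → ℂ}
    {g : ℂ → ℂ} {U : Set ℂ} (hU : IsOpen U) (hUc : IsPreconnected U)
    (hF : ∀ᶠ i in l, DifferentiableOn ℂ (F i) U) (hinj : ∀ᶠ i in l, InjOn (F i) U)
    (hlim : TendstoLocallyUniformlyOn F g l U) {x₀ : ℂ} (hx₀ : x₀ ∈ U) (hd : deriv g x₀ ≠ 0) :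
    InjOn g U := by
  intro a ha b hb hab
  by_contra hne
  have hg : AnalyticOnNhd ℂ g U := (hlim.differentiableOn hF hU).analyticOnNhd hU
  have hev : ∀ᶠ z in 𝓝[≠] a, g z ≠ g a := by
    refine ((hg a ha).eventually_eq_or_eventually_ne analyticAt_const).resolve_left fun h => ?_
    have h1 : EqOn g (fun _ => g a) U :=
      hg.eqOn_of_preconnected_of_eventuallyEq analyticOnNhd_const hUc ha h
    apply hd
    rw [(h1.eventuallyEq_of_mem (hU.mem_nhds hx₀)).deriv_eq, deriv_const]
  rw [eventually_nhdsWithin_iff] at hev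
  -- The closed disc lies in U, omits b, and contains no other solution of g z = g a than its
  -- centre.
  obtain ⟨r, hr, hball⟩ := nhds_basis_closedBall.eventually_iff.1
    (hev.and ((hU.eventually_mem ha).and (isOpen_ne.eventually_mem hne)))
  have hsub : closedBall a r ⊆ U := fun z hz => (hball hz).2.1
  obtain ⟨m, hm, hmin⟩ : ∃ m > 0, ∀ z ∈ sphere a r, m ≤ ‖g z - g a‖ := by
    obtain ⟨z, hz, hz'⟩ := (isCompact_sphere a r).exists_isMinOn
      (NormedSpace.sphere_nonempty.2 hr.le)
      ((hg.continuousOn.mono (sphere_subset_closedBall.trans hsub)).sub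
        (continuousOn_const (c := g a))).norm
    refine ⟨_, norm_pos_iff.2 (sub_ne_zero.2 ((hball (sphere_subset_closedBall hz)).1 ?_)), hz'⟩
    exact ne_of_mem_sphere hz hr.ne'
  have hunif := (tendstoLocallyUniformlyOn_iff_forall_isCompact hU).1 hlim _ hsub
    (isCompact_closedBall a r)
  have hlb : Tendsto (fun i => dist (F i b) (F i a)) l (𝓝 0) := by
    have := (hlim.tendsto_at hb).dist (hlim.tendsto_at ha)
    rwa [hab, dist_self] at this
  obtain ⟨i, hFi, hinji, hui, hbi⟩ := (hF.and (hinj.and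
    ((Metric.tendstoUniformlyOn_iff.1 hunif (m / 4) (by positivity)).and
      (hlb.eventually_lt_const (show 0 < m / 4 by positivity))))).exists
  -- m/2 = m - m/4 - m/4. The quantitative open mapping theorem then makes the image of the disc
  -- cover the ball of radius m/4 about `F i a`, hence `F i b`.
  have hbd : ∀ z ∈ sphere a r, m / 2 ≤ ‖F i z - F i a‖ := by
    intro z hz
    have h1 := hmin z hz
    have h2 := hui z (sphere_subset_closedBall hz)
    have h3 := hui a (mem_closedBall_self hr.le)
    rw [← dist_eq_norm] at h1 ⊢
    have h4 := dist_triangle4 (g z) (F i z) (F i a) (g a)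
    rw [dist_comm (F i a)] at h4
    linarith
  have himg := ((hFi.mono (closure_ball_subset_closedBall.trans hsub)).diffContOnCl
    ).ball_subset_image_closedBall hr hbd (by
      have h1 : ∀ᶠ z in 𝓝[≠] a, F i z ≠ F i a := by
        filter_upwards [nhdsWithin_le_nhds (hU.mem_nhds ha), self_mem_nhdsWithin] with z hz hza h
        exact hza (hinji hz ha h)
      exact h1.frequently.filter_mono nhdsWithin_le_nhds)
  obtain ⟨z, hz, hzb⟩ := himg (show F i b ∈ ball (F i a) (m / 2 / 2) by
    rw [mem_ball]; linarith)
  exact (hball hz).2.2 (hinji (hsub hz) hb hzb)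

/-! ### Montel's theorem -/

/-- The holomorphic functions `U → closedBall 0 1`, as continuous functions on `U`. -/
def boundedHolomorphic (U : Set ℂ) : Set C(U, ℂ) :=
  {g | DifferentiableOn ℂ (Function.extend Subtype.val g 0) U ∧ ∀ z, ‖g z‖ ≤ 1}

theorem extend_apply_mem {U : Set ℂ} (g : U → ℂ) {z : ℂ} (hz : z ∈ U) :
    Function.extend Subtype.val g 0 z = g ⟨z, hz⟩ :=
  Subtype.val_injective.extend_apply g 0 ⟨z, hz⟩

/-- Compactness lives in the compact-open topology of C(U, ℂ), complex analysis in functions on ℂ;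
this passes from the first to the second. -/
theorem tendstoLocallyUniformlyOn_extend {ι : Type*} {l : Filter ι} {U : Set ℂ} (hU : IsOpen U)
    {F : ι → C(U, ℂ)} {g : C(U, ℂ)} (h : Tendsto F l (𝓝 g)) :
    TendstoLocallyUniformlyOn (fun i => Function.extend Subtype.val (F i) 0)
      (Function.extend Subtype.val g 0) l U := by
  have := hU.locallyCompactSpace
  rw [ContinuousMap.tendsto_iff_tendstoLocallyUniformly] at h
  rw [tendstoLocallyUniformlyOn_iff_tendstoLocallyUniformly_comp_coe]
  convert h using 1
  · ext i z
    exact extend_apply_mem _ z.2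
  · ext z
    exact extend_apply_mem _ z.2

/-- By the Schwarz lemma on a disc of radius r inside U: values differ by at most 2, so every member
has the modulus (2/r)·dist at the centre. -/
theorem equicontinuous_boundedHolomorphic {U : Set ℂ} (hU : IsOpen U) :
    Equicontinuous ((↑) : boundedHolomorphic U → U → ℂ) := by
  intro x
  obtain ⟨r, hr, hball⟩ := Metric.isOpen_iff.1 hU x x.2
  refine Metric.equicontinuousAt_of_continuity_modulus (x₀ := x)
    (fun y : U => 2 / r * dist (y : ℂ) x) ?_ (fun g : boundedHolomorphic U => ⇑g.1) ?_
  · have : Continuous fun y : U => 2 / r * dist (y : ℂ) x := by fun_prop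
    simpa using this.tendsto x
  · have : ∀ᶠ y : U in 𝓝 x, (y : ℂ) ∈ ball (x : ℂ) r :=
      continuous_subtype_val.continuousAt (ball_mem_nhds _ hr)
    filter_upwards [this] with y hy g
    have h := Complex.dist_le_div_mul_dist_of_mapsTo_ball (R₂ := 2) (g.2.1.mono hball) (by
      intro z hz
      rw [extend_apply_mem _ (hball hz), extend_apply_mem _ x.2, mem_closedBall]
      exact (dist_le_norm_add_norm _ _).trans (by linarith [g.2.2 ⟨z, hball hz⟩, g.2.2 x]))
      hy
    rw [extend_apply_mem _ y.2, extend_apply_mem _ x.2] at h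
    rw [dist_comm]
    exact h

theorem isClosed_boundedHolomorphic {U : Set ℂ} (hU : IsOpen U) :
    IsClosed (boundedHolomorphic U) := by
  rw [isClosed_iff_clusterPt]
  intro g hg
  have : (𝓝[boundedHolomorphic U] g).NeBot := mem_closure_iff_nhdsWithin_neBot.1
    (mem_closure_iff_clusterPt.2 hg)
  have hT : Tendsto id (𝓝[boundedHolomorphic U] g) (𝓝 g) := nhdsWithin_le_nhds
  refine ⟨(tendstoLocallyUniformlyOn_extend hU hT).differentiableOn ?_ hU, fun z => ?_⟩
  · filter_upwards [self_mem_nhdsWithin] with f hf using hf.1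
  · refine le_of_tendsto (((continuous_eval_const z).tendsto g).comp hT).norm ?_
    filter_upwards [self_mem_nhdsWithin] with f hf using hf.2 z

/-- **Montel's theorem** for functions bounded by one. -/
theorem isCompact_boundedHolomorphic {U : Set ℂ} (hU : IsOpen U) :
    IsCompact (boundedHolomorphic U) := by
  have := hU.locallyCompactSpace
  rw [← (isClosed_boundedHolomorphic hU).closure_eq]
  refine ArzelaAscoli.isCompact_closure_of_isClosedEmbedding (𝔖 := {K | IsCompact K})
    (F := fun f : C(U, ℂ) => (f : U → ℂ)) (fun K hK => hK)
    ⟨ContinuousMap.isUniformEmbedding_toUniformOnFunIsCompact.isEmbedding, ?_⟩ ?_ ?_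
  · convert! UniformOnFun.isClosed_setOfPred_continuous (α := U) (β := ℂ)
      (𝔖 := {K : Set U | IsCompact K}) ?_
    · exact ContinuousMap.range_toUniformOnFunIsCompact
    · exact .of_nhds exists_compact_mem_nhds
  · exact fun K _ => (equicontinuous_boundedHolomorphic hU).equicontinuousOn K
  · exact fun K _ x _ => ⟨closedBall 0 1, isCompact_closedBall 0 1, fun g hg => by
      simpa using hg.2 x⟩

/-! ### Square roots, Blaschke factors and Koebe's trick -/

/-- A continuous square root of a nonvanishing holomorphic function is holomorphic. -/
theorem hasDerivAt_of_sq {s q : ℂ → ℂ} {z q' : ℂ} (hs : ContinuousAt s z) (h0 : s z ≠ 0)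
    (hsq : ∀ w, s w ^ 2 = q w) (hq : HasDerivAt q q' z) : HasDerivAt s (q' / (2 * s z)) z := by
  have hsum : Tendsto (fun w => s w + s z) (𝓝[≠] z) (𝓝 (2 * s z)) := by
    rw [two_mul]
    exact (hs.tendsto.mono_left nhdsWithin_le_nhds).add tendsto_const_nhds
  have h2 : 2 * s z ≠ 0 := mul_ne_zero two_ne_zero h0
  rw [hasDerivAt_iff_tendsto_slope] at hq ⊢
  -- The slope of s is the slope of s² divided by s w + s z.
  refine (hq.div hsum h2).congr' ?_
  filter_upwards [hsum.eventually_ne h2, self_mem_nhdsWithin] with w hw hwz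
  have hwz' : w - z ≠ 0 := sub_ne_zero.2 hwz
  rw [Pi.div_apply, slope_def_field, slope_def_field, ← hsq, ← hsq]
  field_simp
  ring

/-- The Blaschke factor exchanging `0` and `a`, up to sign. -/
noncomputable def blaschke (a z : ℂ) : ℂ := (z - a) / (1 - conj a * z)

theorem one_sub_conj_mul_ne_zero {a z : ℂ} (ha : ‖a‖ < 1) (hz : ‖z‖ < 1) :
    1 - conj a * z ≠ 0 := by
  intro h
  have h1 : ‖conj a * z‖ = 1 := by rw [← sub_eq_zero.1 h, norm_one]
  rw [norm_mul, RCLike.norm_conj] at h1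
  nlinarith [norm_nonneg a, norm_nonneg z]

/-- From |1 - āz|² - |z - a|² = (1 - |a|²)(1 - |z|²). -/
theorem norm_blaschke_lt_one {a z : ℂ} (ha : ‖a‖ < 1) (hz : ‖z‖ < 1) : ‖blaschke a z‖ < 1 := by
  rw [blaschke, norm_div, div_lt_one (norm_pos_iff.2 (one_sub_conj_mul_ne_zero ha hz))]
  refine lt_of_pow_lt_pow_left₀ 2 (norm_nonneg _) ?_
  have ha' : 0 < 1 - ‖a‖ ^ 2 := by nlinarith [norm_nonneg a]
  have hz' : 0 < 1 - ‖z‖ ^ 2 := by nlinarith [norm_nonneg z]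
  have key := mul_pos ha' hz'
  rw [← Complex.normSq_eq_norm_sq, ← Complex.normSq_eq_norm_sq] at key ⊢
  simp only [Complex.normSq_apply, Complex.sub_re, Complex.sub_im, Complex.mul_re, Complex.mul_im,
    Complex.conj_re, Complex.conj_im, Complex.one_re, Complex.one_im] at key ⊢
  nlinarith

theorem blaschke_injOn {a : ℂ} (ha : ‖a‖ < 1) : InjOn (blaschke a) (ball 0 1) := by
  intro z hz w hw h
  rw [mem_ball_zero_iff] at hz hw
  rw [blaschke, blaschke, div_eq_div_iff (one_sub_conj_mul_ne_zero ha hz)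
    (one_sub_conj_mul_ne_zero ha hw)] at h
  have h1 := one_sub_conj_mul_ne_zero ha ha
  have h2 : (1 - conj a * a) * (z - w) = 0 := by linear_combination h
  exact sub_eq_zero.1 ((mul_eq_zero.1 h2).resolve_left h1)

theorem hasDerivAt_blaschke {a z : ℂ} (ha : ‖a‖ < 1) (hz : ‖z‖ < 1) :
    HasDerivAt (blaschke a) ((1 - conj a * a) / (1 - conj a * z) ^ 2) z := by
  have h := ((hasDerivAt_id z).sub_const a).div
    (((hasDerivAt_id z).const_mul (conj a)).const_sub 1) (one_sub_conj_mul_ne_zero ha hz)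
  have e : (1 - conj a * a) / (1 - conj a * z) ^ 2 =
      (1 * (1 - conj a * z) - (z - a) * -(conj a * 1)) / (1 - conj a * z) ^ 2 := by ring
  rw [e]
  exact h

/-- Koebe's trick: an injective holomorphic map into the disc that misses a point of the disc can
be replaced by one with a larger derivative. -/
theorem exists_norm_deriv_lt {U : Set ℂ} (hU : IsOpen U) (hUc : IsSimplyConnected U) {g : ℂ → ℂ}
    (hg : DifferentiableOn ℂ g U) (hmaps : MapsTo g U (ball 0 1)) (hinj : InjOn g U) {x₀ : ℂ}
    (hx₀ : x₀ ∈ U) (h0 : g x₀ = 0) {w : ℂ} (hw : w ∈ ball (0 : ℂ) 1) (hwg : w ∉ g '' U) :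
    ∃ h : ℂ → ℂ, DifferentiableOn ℂ h U ∧ MapsTo h U (ball 0 1) ∧ InjOn h U ∧ h x₀ = 0 ∧
      ‖deriv g x₀‖ < ‖deriv h x₀‖ := by
  rw [mem_ball_zero_iff] at hw
  have hgn : ∀ z ∈ U, ‖g z‖ < 1 := fun z hz => mem_ball_zero_iff.1 (hmaps hz)
  have hgd : ∀ z ∈ U, HasDerivAt g (deriv g z) z := fun z hz =>
    (hg.differentiableAt (hU.mem_nhds hz)).hasDerivAt
  have hqd : ∀ z ∈ U, HasDerivAt (fun z => blaschke w (g z))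
      ((1 - conj w * w) / (1 - conj w * g z) ^ 2 * deriv g z) z := fun z hz =>
    (hasDerivAt_blaschke hw (hgn z hz)).comp z (hgd z hz)
  have hq0 : ∀ z ∈ U, blaschke w (g z) ≠ 0 := by
    intro z hz h
    rcases div_eq_zero_iff.1 h with h | h
    · exact hwg ⟨z, hz, sub_eq_zero.1 h⟩
    · exact one_sub_conj_mul_ne_zero hw (hgn z hz) h
  -- As w is omitted by g, the composite has no zero, so simple connectivity yields a square root.
  obtain ⟨s, hsc, hs⟩ := Complex.exists_continuousOn_pow_eq hUc hU
    (fun z hz => (hqd z hz).continuousAt.continuousWithinAt)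
    (by rintro ⟨z, hz, h⟩; exact hq0 z hz h) two_ne_zero
  have hs0 : ∀ z ∈ U, s z ≠ 0 := fun z hz h => hq0 z hz (by rw [← hs, h]; simp)
  have hsd : ∀ z ∈ U, HasDerivAt s _ z := fun z hz =>
    hasDerivAt_of_sq (hsc.continuousAt (hU.mem_nhds hz)) (hs0 z hz) hs (hqd z hz)
  have hsn : ∀ z ∈ U, ‖s z‖ < 1 := by
    intro z hz
    have := norm_blaschke_lt_one hw (hgn z hz)
    rw [← hs, norm_pow] at this
    exact (pow_lt_one_iff_of_nonneg (norm_nonneg _) two_ne_zero).1 this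
  set b := s x₀ with hb
  have hbn : ‖b‖ < 1 := hsn x₀ hx₀
  have hb0 : 0 < ‖b‖ := norm_pos_iff.2 (hs0 x₀ hx₀)
  have hhd : ∀ z ∈ U, HasDerivAt (fun z => blaschke b (s z)) _ z := fun z hz =>
    (hasDerivAt_blaschke hbn (hsn z hz)).comp z (hsd z hz)
  refine ⟨fun z => blaschke b (s z), fun z hz => (hhd z hz).differentiableAt.differentiableWithinAt,
    fun z hz => mem_ball_zero_iff.2 (norm_blaschke_lt_one hbn (hsn z hz)), ?_, ?_, ?_⟩
  · intro z hz z' hz' h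
    have h1 : s z = s z' := blaschke_injOn hbn (mem_ball_zero_iff.2 (hsn z hz))
      (mem_ball_zero_iff.2 (hsn z' hz')) h
    apply hinj hz hz'
    apply blaschke_injOn hw (hmaps hz) (hmaps hz')
    rw [← hs, ← hs, h1]
  · simp [blaschke, ← hb]
  · have hbw : ‖b‖ ^ 2 = ‖w‖ := by
      rw [← norm_pow, hb, hs, h0]
      simp [blaschke]
    have hg0 : 0 < ‖deriv g x₀‖ := norm_pos_iff.2 (deriv_ne_zero_of_injOn hU hg hinj hx₀)
    have hn : ∀ a : ℂ, ‖a‖ < 1 → ‖1 - conj a * a‖ = 1 - ‖a‖ ^ 2 := by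
      intro a ha
      rw [mul_comm, Complex.mul_conj, Complex.normSq_eq_norm_sq]
      have : 0 ≤ 1 - ‖a‖ ^ 2 := by nlinarith [norm_nonneg a]
      rw [← Complex.ofReal_one, ← Complex.ofReal_sub, Complex.norm_real, Real.norm_of_nonneg this]
    rw [(hhd x₀ hx₀).deriv]
    simp only [← hb, h0, norm_mul, norm_div, norm_pow, hn b hbn, hn w hw, mul_zero, sub_zero,
      one_pow, div_one, Complex.norm_ofNat]
    rw [← hbw]
    have h1 : 0 < 1 - ‖b‖ ^ 2 := by nlinarith
    -- The gain factor (1 + |b|²)/(2|b|) exceeds 1 because (1 - |b|)² > 0.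
    rw [show (1 - ‖b‖ ^ 2) / (1 - ‖b‖ ^ 2) ^ 2 * ((1 - (‖b‖ ^ 2) ^ 2) * ‖deriv g x₀‖ / (2 * ‖b‖))
      = ‖deriv g x₀‖ * ((1 + ‖b‖ ^ 2) / (2 * ‖b‖)) by field_simp; ring]
    refine lt_mul_of_one_lt_right hg0 ?_
    rw [one_lt_div (by positivity)]
    nlinarith [sq_pos_of_pos (sub_pos.2 hbn)]

/-- A simply connected proper domain admits an injective holomorphic map into the unit disc. -/
theorem exists_mapsTo_ball_injOn {U : Set ℂ} (hU : IsOpen U) (hUc : IsSimplyConnected U)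
    (hne : U ≠ univ) :
    ∃ h : ℂ → ℂ, DifferentiableOn ℂ h U ∧ MapsTo h U (ball 0 1) ∧ InjOn h U := by
  obtain ⟨a, ha⟩ := (ne_univ_iff_exists_notMem U).1 hne
  obtain ⟨x, hx⟩ := hUc.nonempty
  have ha0 : ∀ z ∈ U, z - a ≠ 0 := fun z hz h => ha (sub_eq_zero.1 h ▸ hz)
  obtain ⟨s, hsc, hs⟩ := Complex.exists_continuousOn_pow_eq hUc hU
    (g := fun z => z - a) (by fun_prop) (by rintro ⟨z, hz, h⟩; exact ha0 z hz h) two_ne_zero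
  have hs0 : ∀ z ∈ U, s z ≠ 0 := fun z hz h => ha0 z hz (by rw [← hs, h]; simp)
  have hsd : DifferentiableOn ℂ s U := fun z hz =>
    (hasDerivAt_of_sq (hsc.continuousAt (hU.mem_nhds hz)) (hs0 z hz) hs
      ((hasDerivAt_id z).sub_const a)).differentiableAt.differentiableWithinAt
  have hsi : ∀ z w, s z ^ 2 = s w ^ 2 → z = w := by
    intro z w h
    rw [hs, hs] at h
    exact sub_left_injective h
  have hsinj : InjOn s U := fun z _ w _ h => hsi z w (by rw [h])
  have hnhds : s '' U ∈ 𝓝 (s x) := by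
    rw [← (hsd.analyticAt (hU.mem_nhds hx)).hasStrictDerivAt.map_nhds_eq
      (deriv_ne_zero_of_injOn hU hsd hsinj hx)]
    exact image_mem_map (hU.mem_nhds hx)
  obtain ⟨ε, hε, hball⟩ := Metric.mem_nhds_iff.1 hnhds
  -- A root of z - a cannot take both a value and its opposite, so s avoids the reflection of the
  -- ε-ball contained in its image.
  have hlow : ∀ z ∈ U, ε ≤ ‖s z + s x‖ := by
    intro z hz
    by_contra! h
    obtain ⟨w, hw, hwz⟩ := hball (show -s z ∈ ball (s x) ε by
      rw [mem_ball, dist_eq_norm, ← norm_neg]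
      rwa [neg_sub, sub_neg_eq_add, add_comm])
    have : w = z := hsi w z (by rw [hwz, neg_sq])
    rw [this] at hwz
    exact hs0 z hz (self_eq_neg.1 hwz)
  have hsum : ∀ z ∈ U, s z + s x ≠ 0 := fun z hz => norm_pos_iff.1 (hε.trans_le (hlow z hz))
  refine ⟨fun z => (ε / 2 : ℝ) / (s z + s x),
    (differentiableOn_const _).div (hsd.add_const _) hsum, fun z hz => ?_, fun z hz w hw h => ?_⟩
  · rw [mem_ball_zero_iff, norm_div, Complex.norm_real, Real.norm_of_nonneg (by positivity),
      div_lt_one (norm_pos_iff.2 (hsum z hz))]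
    linarith [hlow z hz]
  · have hε' : ((ε / 2 : ℝ) : ℂ) ≠ 0 := Complex.ofReal_ne_zero.2 (by positivity)
    exact hsinj hz hw (add_left_injective (s x) (inv_injective (mul_left_cancel₀ hε' (by
      simpa only [div_eq_mul_inv] using h))))

/-! ### Existence in the Riemann mapping theorem -/

/-- The **Riemann mapping theorem**. -/
theorem exists_bijOn_ball {U : Set ℂ} (hU : IsOpen U) (hUc : IsSimplyConnected U)
    (hne : U ≠ univ) {x₀ : ℂ} (hx₀ : x₀ ∈ U) :
    ∃ φ : ℂ → ℂ, DifferentiableOn ℂ φ U ∧ BijOn φ U (ball 0 1) ∧ φ x₀ = 0 ∧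
      ∃ c : ℝ, 0 < c ∧ deriv φ x₀ = c := by
  have hUp : IsPreconnected U := hUc.isPathConnected.isConnected.isPreconnected
  let S : Set C(U, ℂ) := {f | f ∈ boundedHolomorphic U ∧ InjOn (Function.extend Subtype.val f 0) U}
  let D : C(U, ℂ) → ℝ := fun f => ‖deriv (Function.extend Subtype.val f 0) x₀‖
  have hSsub : S ⊆ boundedHolomorphic U := fun f hf => hf.1
  have hcl : closure S ⊆ boundedHolomorphic U :=
    closure_minimal hSsub (isClosed_boundedHolomorphic hU)
  have hK : IsCompact (closure S) :=
    (isCompact_boundedHolomorphic hU).of_isClosed_subset isClosed_closure hcl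
  have hD : ContinuousOn D (closure S) := by
    intro f hf
    have hT : Tendsto id (𝓝[closure S] f) (𝓝 f) := nhdsWithin_le_nhds
    have h1 := (tendstoLocallyUniformlyOn_extend hU hT).deriv
      (by filter_upwards [self_mem_nhdsWithin] with f hf using (hcl hf).1) hU
    exact (h1.tendsto_at hx₀).norm
  have hmk : ∀ h : ℂ → ℂ, DifferentiableOn ℂ h U → MapsTo h U (ball 0 1) → InjOn h U →
      ∃ f ∈ S, D f = ‖deriv h x₀‖ := by
    intro h hd hm hi
    let f : C(U, ℂ) := ⟨U.domRestrict h, hd.continuousOn.domRestrict⟩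
    have hf : EqOn (Function.extend Subtype.val f 0) h U := fun z hz => extend_apply_mem _ hz
    refine ⟨f, ⟨⟨hd.congr hf, fun z => (mem_ball_zero_iff.1 (hm z.2)).le⟩, hi.congr hf.symm⟩, ?_⟩
    simp only [D, (hf.eventuallyEq_of_mem (hU.mem_nhds hx₀)).deriv_eq]
  obtain ⟨h, hhd, hhm, hhi⟩ := exists_mapsTo_ball_injOn hU hUc hne
  obtain ⟨f₁, hf₁, hDf₁⟩ := hmk h hhd hhm hhi
  -- The maximum is taken over the closure, since `S` need not be closed: limits may be constant.
  -- The positive derivative at the maximizer excludes this.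
  obtain ⟨f, hf, hmax⟩ := hK.exists_isMaxOn ⟨f₁, subset_closure hf₁⟩ hD
  set g := Function.extend Subtype.val f 0 with hgdef
  have hgd : DifferentiableOn ℂ g U := (hcl hf).1
  have hg' : deriv g x₀ ≠ 0 := by
    rw [← norm_pos_iff]
    refine lt_of_lt_of_le ?_ (hmax (subset_closure hf₁))
    rw [hDf₁]
    exact norm_pos_iff.2 (deriv_ne_zero_of_injOn hU hhd hhi hx₀)
  have hgi : InjOn g U := by
    have : (𝓝[S] f).NeBot := mem_closure_iff_nhdsWithin_neBot.1 hf
    have hT : Tendsto id (𝓝[S] f) (𝓝 f) := nhdsWithin_le_nhds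
    refine injOn_of_tendstoLocallyUniformlyOn hU hUp ?_ ?_
      (tendstoLocallyUniformlyOn_extend hU hT) hx₀ hg'
    · filter_upwards [self_mem_nhdsWithin] with f hf using hf.1.1
    · filter_upwards [self_mem_nhdsWithin] with f hf using hf.2
  -- The limit is only bounded by 1; its image is open, hence inside the open disc.
  have hgm : MapsTo g U (ball 0 1) := by
    have hopen : IsOpen (g '' U) := by
      refine ((hgd.analyticOnNhd hU).is_constant_or_isOpen hUp).resolve_left ?_ U subset_rfl hU
      rintro ⟨w, hw⟩
      apply hg'
      rw [((show EqOn g (fun _ => w) U from hw).eventuallyEq_of_mem (hU.mem_nhds hx₀)).deriv_eq,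
        deriv_const]
    have hsub : g '' U ⊆ closedBall 0 1 := by
      rintro _ ⟨z, hz, rfl⟩
      rw [mem_closedBall_zero_iff, hgdef, extend_apply_mem _ hz]
      exact (hcl hf).2 _
    rw [mapsTo_iff_image_subset, ← interior_closedBall (0 : ℂ) one_ne_zero]
    exact hopen.subset_interior_iff.2 hsub
  have hg₀ : ‖g x₀‖ < 1 := mem_ball_zero_iff.1 (hgm hx₀)
  have hbest : ∀ k : ℂ → ℂ, DifferentiableOn ℂ k U → MapsTo k U (ball 0 1) → InjOn k U →
      ‖deriv k x₀‖ ≤ ‖deriv g x₀‖ := by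
    intro k hd hm hi
    obtain ⟨f₂, hf₂, hDf₂⟩ := hmk k hd hm hi
    rw [← hDf₂]
    exact hmax (subset_closure hf₂)
  set a := g x₀ with hadef
  -- Moving g x₀ to 0 divides the derivative by 1 - |a|² ≤ 1, so `k` is still extremal.
  let k : ℂ → ℂ := fun z => blaschke a (g z)
  have hkd : ∀ z ∈ U, HasDerivAt k ((1 - conj a * a) / (1 - conj a * g z) ^ 2 * deriv g z) z :=
    fun z hz => (hasDerivAt_blaschke hg₀ (mem_ball_zero_iff.1 (hgm hz))).comp z
      (hgd.differentiableAt (hU.mem_nhds hz)).hasDerivAt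
  have hkdo : DifferentiableOn ℂ k U := fun z hz =>
    (hkd z hz).differentiableAt.differentiableWithinAt
  have hkm : MapsTo k U (ball 0 1) := fun z hz =>
    mem_ball_zero_iff.2 (norm_blaschke_lt_one hg₀ (mem_ball_zero_iff.1 (hgm hz)))
  have hki : InjOn k U := (blaschke_injOn hg₀).comp hgi hgm
  have hk0 : k x₀ = 0 := by simp [k, blaschke, ← hadef]
  have hkg : ‖deriv g x₀‖ ≤ ‖deriv k x₀‖ := by
    have h1 : 1 - conj a * a ≠ 0 := one_sub_conj_mul_ne_zero hg₀ hg₀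
    have h2 : deriv g x₀ = (1 - conj a * a) * deriv k x₀ := by
      rw [(hkd x₀ hx₀).deriv, ← hadef]
      field_simp
    have h3 : ‖1 - conj a * a‖ ≤ 1 := by
      rw [mul_comm, Complex.mul_conj, Complex.normSq_eq_norm_sq, ← Complex.ofReal_one,
        ← Complex.ofReal_sub, Complex.norm_real, Real.norm_of_nonneg]
      · nlinarith [norm_nonneg a]
      · nlinarith [norm_nonneg a]
    rw [h2, norm_mul]
    exact mul_le_of_le_one_left (norm_nonneg _) h3
  have hks : SurjOn k U (ball 0 1) := by
    intro w hw
    by_contra hwk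
    obtain ⟨p, hpd, hpm, hpi, -, hlt⟩ :=
      exists_norm_deriv_lt hU hUc hkdo hkm hki hx₀ hk0 hw hwk
    exact absurd (hbest p hpd hpm hpi) (not_le.2 (hkg.trans_lt hlt))
  set d := deriv k x₀ with hd
  have hd0 : 0 < ‖d‖ := norm_pos_iff.2 (deriv_ne_zero_of_injOn hU hkdo hki hx₀)
  -- The rotation making the derivative equal to |d|.
  set u : ℂ := conj d / ‖d‖ with hu
  have hun : ‖u‖ = 1 := by
    rw [hu, norm_div, RCLike.norm_conj, Complex.norm_real, norm_norm, div_self hd0.ne']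
  have hu0 : u ≠ 0 := norm_pos_iff.1 (by rw [hun]; exact one_pos)
  refine ⟨fun z => u * k z, hkdo.const_mul u, ⟨fun z hz => ?_, fun z hz w hw h => ?_, ?_⟩,
    by simp [hk0], ‖d‖, hd0, ?_⟩
  · rw [mem_ball_zero_iff, norm_mul, hun, one_mul]
    exact mem_ball_zero_iff.1 (hkm hz)
  · exact hki hz hw (mul_left_cancel₀ hu0 h)
  · intro w hw
    obtain ⟨z, hz, hzw⟩ := hks (show w / u ∈ ball 0 1 by
      rw [mem_ball_zero_iff, norm_div, hun, div_one]
      exact mem_ball_zero_iff.1 hw)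
    exact ⟨z, hz, by simp only [hzw]; field_simp⟩
  · rw [deriv_const_mul u (hkd x₀ hx₀).differentiableAt, ← hd, hu, div_mul_eq_mul_div,
      Complex.conj_mul', sq, mul_div_assoc, div_self (Complex.ofReal_ne_zero.2 hd0.ne'), mul_one]

/-! ### Uniqueness and symmetry of the Riemann map -/

/-- Two Riemann maps with the same base point differ by a holomorphic self-map of the disc that
fixes the origin. -/
theorem exists_mapsTo_ball_comp_eq {U : Set ℂ} (hU : IsOpen U) {φ ψ : ℂ → ℂ} {x₀ : ℂ}
    (hφ : DifferentiableOn ℂ φ U) (hφb : BijOn φ U (ball 0 1)) (hφ0 : φ x₀ = 0)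
    (hψ : DifferentiableOn ℂ ψ U) (hψb : BijOn ψ U (ball 0 1)) (hψ0 : ψ x₀ = 0) (hx₀ : x₀ ∈ U) :
    ∃ T : ℂ → ℂ, DifferentiableOn ℂ T (ball 0 1) ∧ MapsTo T (ball 0 1) (ball 0 1) ∧ T 0 = 0 ∧
      (∀ z ∈ U, T (φ z) = ψ z) ∧ deriv ψ x₀ = deriv T 0 * deriv φ x₀ ∧ ‖deriv T 0‖ ≤ 1 := by
  have hinv : ∀ z ∈ U, Function.invFunOn φ U (φ z) = z := fun z hz =>
    hφb.injOn.leftInvOn_invFunOn hz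
  have hm : MapsTo (Function.invFunOn φ U) (ball 0 1) U := hφb.surjOn.mapsTo_invFunOn
  have hT : DifferentiableOn ℂ (ψ ∘ Function.invFunOn φ U) (ball 0 1) :=
    hψ.comp (differentiableOn_invFunOn hU hφ hφb) hm
  have hTm : MapsTo (ψ ∘ Function.invFunOn φ U) (ball 0 1) (ball 0 1) := hψb.mapsTo.comp hm
  have hTφ : ∀ z ∈ U, (ψ ∘ Function.invFunOn φ U) (φ z) = ψ z := fun z hz => by
    simp only [Function.comp_apply, hinv z hz]
  have hT0 : (ψ ∘ Function.invFunOn φ U) 0 = 0 := by rw [← hφ0, hTφ x₀ hx₀, hψ0, hφ0]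
  generalize ψ ∘ Function.invFunOn φ U = T at *
  refine ⟨T, hT, hTm, hT0, hTφ, ?_, ?_⟩
  · have hd : HasDerivAt T (deriv T 0) (φ x₀) := by
      rw [hφ0]
      exact (hT.differentiableAt (isOpen_ball.mem_nhds (mem_ball_self one_pos))).hasDerivAt
    have h1 := (hd.comp x₀ (hφ.differentiableAt (hU.mem_nhds hx₀)).hasDerivAt).deriv
    rw [← h1]
    exact ((show EqOn (T ∘ φ) ψ U from hTφ).eventuallyEq_of_mem (hU.mem_nhds hx₀)).deriv_eq.symm
  · refine Complex.norm_deriv_le_one_of_mapsTo_ball hT ?_ one_pos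
    rw [hT0]
    exact hTm.mono_right ball_subset_closedBall

/-- Uniqueness of normalized Riemann maps. -/
theorem eqOn_of_bijOn_ball {U : Set ℂ} (hU : IsOpen U) {φ ψ : ℂ → ℂ} {x₀ : ℂ} (hx₀ : x₀ ∈ U)
    (hφ : DifferentiableOn ℂ φ U) (hφb : BijOn φ U (ball 0 1)) (hφ0 : φ x₀ = 0)
    (hψ : DifferentiableOn ℂ ψ U) (hψb : BijOn ψ U (ball 0 1)) (hψ0 : ψ x₀ = 0)
    (hφ' : ∃ c : ℝ, 0 < c ∧ deriv φ x₀ = c) (hψ' : ∃ c : ℝ, 0 < c ∧ deriv ψ x₀ = c) :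
    EqOn ψ φ U := by
  obtain ⟨c, hc, hφc⟩ := hφ'
  obtain ⟨d, hd, hψd⟩ := hψ'
  obtain ⟨T, hT, hTm, hT0, hTφ, hTd, hTn⟩ :=
    exists_mapsTo_ball_comp_eq hU hφ hφb hφ0 hψ hψb hψ0 hx₀
  obtain ⟨T', -, -, -, -, hTd', hTn'⟩ :=
    exists_mapsTo_ball_comp_eq hU hψ hψb hψ0 hφ hφb hφ0 hx₀
  have hle : ∀ {a b : ℝ} {t : ℂ}, 0 < a → 0 < b → (b : ℂ) = t * a → ‖t‖ ≤ 1 → b ≤ a := by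
    intro a b t ha hb h ht
    have := congrArg norm h
    rw [norm_mul, Complex.norm_real, Complex.norm_real, Real.norm_of_nonneg ha.le,
      Real.norm_of_nonneg hb.le] at this
    rw [this]
    exact mul_le_of_le_one_left ha.le ht
  rw [hφc, hψd] at hTd hTd'
  have hcd : d = c := le_antisymm (hle hc hd hTd hTn) (hle hd hc hTd' hTn')
  have hT1 : deriv T 0 = 1 := by
    rw [hcd] at hTd
    exact (mul_eq_right₀ (Complex.ofReal_ne_zero.2 hc.ne')).1 hTd.symm
  -- Equality case of the Schwarz lemma.
  have haff := Complex.affine_of_mapsTo_ball_of_norm_dslope_eq_div hT (R₂ := 1) (z₀ := 0)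
    (by rw [hT0]; exact hTm.mono_right ball_subset_closedBall) (mem_ball_self one_pos)
    (by simp [hT1])
  intro z hz
  rw [← hTφ z hz, haff (hφb.mapsTo hz)]
  simp [hT0, hT1]

/-- The normalized Riemann map of a domain symmetric about the real axis is intrinsic. -/
theorem map_conj_of_bijOn_ball {U : Set ℂ} (hU : IsOpen U) {φ : ℂ → ℂ} {x₀ : ℝ}
    (hx₀ : (x₀ : ℂ) ∈ U) (hφ : DifferentiableOn ℂ φ U) (hφb : BijOn φ U (ball 0 1))
    (hφ0 : φ x₀ = 0) (hφ' : ∃ c : ℝ, 0 < c ∧ deriv φ x₀ = c) (hconj : ∀ z ∈ U, conj z ∈ U) :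
    ∀ z ∈ U, φ (conj z) = conj (φ z) := by
  have hd : ∀ z ∈ U, HasDerivAt (conj ∘ φ ∘ conj) (conj (deriv φ (conj z))) z := fun z hz => by
    simpa using (hφ.differentiableAt (hU.mem_nhds (hconj z hz))).hasDerivAt.conj_conj
  have h := eqOn_of_bijOn_ball hU hx₀ hφ hφb hφ0
    (ψ := conj ∘ φ ∘ conj) (fun z hz => (hd z hz).differentiableAt.differentiableWithinAt)
    ⟨fun z hz => ?_, fun z hz w hw h => ?_, fun w hw => ?_⟩ (by simp [hφ0]) hφ' ?_
  · intro z hz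
    rw [← h hz]
    simp
  · rw [mem_ball_zero_iff, Function.comp_apply, RCLike.norm_conj]
    exact mem_ball_zero_iff.1 (hφb.mapsTo (hconj z hz))
  · exact (starRingEnd ℂ).injective (hφb.injOn (hconj z hz) (hconj w hw)
      ((starRingEnd ℂ).injective h))
  · obtain ⟨z, hz, hzw⟩ := hφb.surjOn (show conj w ∈ ball 0 1 by
      rw [mem_ball_zero_iff, RCLike.norm_conj]; exact mem_ball_zero_iff.1 hw)
    exact ⟨conj z, hconj z hz, by simp [hzw]⟩
  · obtain ⟨c, hc, hc'⟩ := hφ'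
    exact ⟨c, hc, by rw [(hd _ hx₀).deriv, Complex.conj_ofReal, hc', Complex.conj_ofReal]⟩

/-! ### Slices of the quaternions -/

theorem slicePoint_eq (I : ℍ[ℝ]) (x y : ℝ) : slicePoint I x y = (x : ℍ[ℝ]) + y • I := by
  rw [slicePoint, Quaternion.mul_coe_eq_smul]

theorem slicePoint_neg (I : ℍ[ℝ]) (x y : ℝ) : slicePoint (-I) x y = slicePoint I x (-y) := by
  simp [slicePoint_eq]

@[simp]
theorem slicePoint_zero (I : ℍ[ℝ]) (x : ℝ) : slicePoint I x 0 = x := by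
  simp [slicePoint_eq]

theorem neg_mem_imagSphere {I : ℍ[ℝ]} (hI : I ∈ imagSphere) : -I ∈ imagSphere :=
  ⟨by simp [hI.1], by simp [hI.2]⟩

theorem mul_self_of_mem_imagSphere {I : ℍ[ℝ]} (hI : I ∈ imagSphere) : I * I = -1 := by
  have h := Quaternion.sq_eq_neg_normSq.2 hI.1
  rw [Quaternion.normSq_eq_norm_mul_self, hI.2] at h
  simpa [sq] using h

theorem im_of_mem_imagSphere {I : ℍ[ℝ]} (hI : I ∈ imagSphere) : I.im = I := by
  rw [← Quaternion.sub_re_self, hI.1]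
  simp

theorem re_slicePoint {I : ℍ[ℝ]} (hI : I ∈ imagSphere) (x y : ℝ) : (slicePoint I x y).re = x := by
  simp [slicePoint_eq, hI.1]

theorem im_slicePoint {I : ℍ[ℝ]} (hI : I ∈ imagSphere) (x y : ℝ) :
    (slicePoint I x y).im = y • I := by
  simp [slicePoint_eq, im_of_mem_imagSphere hI]

theorem norm_slicePoint {I : ℍ[ℝ]} (hI : I ∈ imagSphere) (z : ℂ) :
    ‖slicePoint I z.re z.im‖ = ‖z‖ := by
  rw [← sq_eq_sq₀ (norm_nonneg _) (norm_nonneg _), slicePoint_eq, ← Complex.normSq_eq_norm_sq,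
    Complex.normSq_apply, sq, ← Quaternion.normSq_eq_norm_mul_self, Quaternion.normSq_add,
    Quaternion.normSq_smul, Quaternion.normSq_eq_norm_mul_self I, hI.2, Quaternion.normSq_coe]
  simp [hI.1]
  ring

/-- The real linear isometry `x + i y ↦ x + I y` onto the slice `ℂ_I`. -/
noncomputable def sliceMap (I : ℍ[ℝ]) : ℂ →L[ℝ] ℍ[ℝ] :=
  Complex.reCLM.smulRight 1 + Complex.imCLM.smulRight I

theorem sliceMap_apply (I : ℍ[ℝ]) (z : ℂ) : sliceMap I z = slicePoint I z.re z.im := by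
  rw [slicePoint_eq, ← mul_one (z.re : ℍ[ℝ]), Quaternion.coe_mul_eq_smul]
  simp [sliceMap]

theorem sliceMap_ofReal (I : ℍ[ℝ]) (x : ℝ) : sliceMap I x = x := by
  simp [sliceMap_apply]

theorem norm_sliceMap {I : ℍ[ℝ]} (hI : I ∈ imagSphere) (z : ℂ) : ‖sliceMap I z‖ = ‖z‖ := by
  rw [sliceMap_apply, norm_slicePoint hI]

theorem sliceMap_neg (I : ℍ[ℝ]) (z : ℂ) : sliceMap (-I) z = sliceMap I (conj z) := by
  simp [sliceMap_apply, slicePoint_neg]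

theorem sliceMap_I_mul {I : ℍ[ℝ]} (hI : I ∈ imagSphere) (z : ℂ) :
    sliceMap I (Complex.I * z) = I * sliceMap I z := by
  simp only [sliceMap_apply, slicePoint_eq, mul_add, Complex.I_mul_re, Complex.I_mul_im,
    mul_smul_comm, mul_self_of_mem_imagSphere hI, Quaternion.mul_coe_eq_smul]
  rw [add_comm, ← Quaternion.mul_coe_eq_smul _ (-1)]
  simp

theorem isometry_sliceMap {I : ℍ[ℝ]} (hI : I ∈ imagSphere) : Isometry (sliceMap I) :=
  AddMonoidHomClass.isometry_of_norm _ (norm_sliceMap hI)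

theorem range_sliceMap (I : ℍ[ℝ]) : range (sliceMap I) = slicePlane I := by
  ext q
  constructor
  · rintro ⟨z, rfl⟩
    exact ⟨z.re, z.im, sliceMap_apply I z⟩
  · rintro ⟨x, y, rfl⟩
    exact ⟨⟨x, y⟩, sliceMap_apply I _⟩

theorem sliceMap_mem_slicePlane (I : ℍ[ℝ]) (z : ℂ) : sliceMap I z ∈ slicePlane I :=
  range_sliceMap I ▸ mem_range_self z

/-- A real linear retraction of `ℍ` onto the slice `ℂ_I`, read in `ℂ`. -/
noncomputable def sliceProj (I : ℍ[ℝ]) : ℍ[ℝ] →L[ℝ] ℂ :=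
  (innerSL ℝ (1 : ℍ[ℝ])).smulRight (1 : ℂ) + (innerSL ℝ I).smulRight Complex.I

theorem sliceProj_apply (I q : ℍ[ℝ]) : sliceProj I q = ⟨q.re, inner ℝ I q⟩ := by
  apply Complex.ext <;> simp [sliceProj, Quaternion.inner_def]

theorem sliceProj_coe {I : ℍ[ℝ]} (hI : I ∈ imagSphere) (x : ℝ) : sliceProj I x = x := by
  apply Complex.ext <;> simp [sliceProj_apply, Quaternion.inner_def, hI.1]

theorem sliceProj_sliceMap {I : ℍ[ℝ]} (hI : I ∈ imagSphere) (z : ℂ) :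
    sliceProj I (sliceMap I z) = z := by
  rw [sliceMap_apply, sliceProj_apply, re_slicePoint hI]
  apply Complex.ext
  · rfl
  · rw [slicePoint_eq, inner_add_right, inner_smul_right, real_inner_self_eq_norm_sq, hI.2,
      Quaternion.inner_def]
    simp [hI.1]

theorem sliceMap_sliceProj {I q : ℍ[ℝ]} (hI : I ∈ imagSphere) (hq : q ∈ slicePlane I) :
    sliceMap I (sliceProj I q) = q := by
  rw [← range_sliceMap] at hq
  obtain ⟨z, rfl⟩ := hq
  rw [sliceProj_sliceMap hI]

/-- Left multiplication by I preserves ℂ_I and its orthogonal complement, so it commutes with the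
orthogonal projection. Hence projecting keeps the Cauchy-Riemann equation. -/
theorem sliceProj_mul {I : ℍ[ℝ]} (hI : I ∈ imagSphere) (q : ℍ[ℝ]) :
    sliceProj I (I * q) = Complex.I * sliceProj I q := by
  have h1 := Quaternion.normSq_eq_norm_mul_self I
  rw [hI.2, Quaternion.normSq_def'] at h1
  have h2 : I.re = 0 := hI.1
  rw [h2] at h1
  apply Complex.ext
  · simp [sliceProj_apply, Quaternion.inner_def, h2]
    ring
  · simp [sliceProj_apply, Quaternion.inner_def, h2]
    linear_combination q.re * h1

/-- The imaginary unit `i`. -/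
def unitI : ℍ[ℝ] := ⟨0, 1, 0, 0⟩

/-- The imaginary unit `j`. -/
def unitJ : ℍ[ℝ] := ⟨0, 0, 1, 0⟩

theorem mem_imagSphere_of_normSq {I : ℍ[ℝ]} (h0 : I.re = 0) (h1 : Quaternion.normSq I = 1) :
    I ∈ imagSphere :=
  ⟨h0, by rwa [← sq_eq_sq₀ (norm_nonneg _) zero_le_one, sq, ← Quaternion.normSq_eq_norm_mul_self,
    one_pow]⟩

theorem unitI_mem_imagSphere : unitI ∈ imagSphere :=
  mem_imagSphere_of_normSq rfl (by rw [Quaternion.normSq_def']; simp [unitI])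

theorem unitJ_mem_imagSphere : unitJ ∈ imagSphere :=
  mem_imagSphere_of_normSq rfl (by rw [Quaternion.normSq_def']; simp [unitJ])

/-- Two slices, ℂ_i and ℂ_j, already meet only in ℝ. Hence intrinsic functions are real at real
points. -/
theorem eq_coe_re_of_forall_mem_slicePlane {q : ℍ[ℝ]}
    (h : ∀ I ∈ imagSphere, q ∈ slicePlane I) : q = q.re := by
  obtain ⟨x, y, hI⟩ := h unitI unitI_mem_imagSphere
  obtain ⟨x', y', hJ⟩ := h unitJ unitJ_mem_imagSphere
  rw [slicePoint_eq] at hI hJ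
  have h1 : q.imI = 0 := by
    rw [hJ, Quaternion.imI_add, Quaternion.imI_smul, show unitJ.imI = 0 from rfl]
    simp
  have h2 : q.imJ = 0 := by
    rw [hI, Quaternion.imJ_add, Quaternion.imJ_smul, show unitI.imJ = 0 from rfl]
    simp
  have h3 : q.imK = 0 := by
    rw [hI, Quaternion.imK_add, Quaternion.imK_smul, show unitI.imK = 0 from rfl]
    simp
  ext <;> simp [h1, h2, h3]

theorem exists_sliceMap_eq (q : ℍ[ℝ]) :
    ∃ I ∈ imagSphere, sliceMap I ⟨q.re, ‖q.im‖⟩ = q := by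
  by_cases h : q.im = 0
  · refine ⟨unitI, unitI_mem_imagSphere, ?_⟩
    rw [sliceMap_apply, h, norm_zero, slicePoint_zero, ← Quaternion.sub_im_self, h, sub_zero]
  · have hn : ‖q.im‖ ≠ 0 := norm_ne_zero_iff.2 h
    refine ⟨‖q.im‖⁻¹ • q.im, ⟨by simp, ?_⟩, ?_⟩
    · rw [norm_smul, norm_inv, norm_norm, inv_mul_cancel₀ hn]
    · rw [sliceMap_apply, slicePoint_eq, smul_inv_smul₀ hn, Quaternion.re_add_im]

/-- Two distinct slices meet in the real axis only. -/
theorem sliceMap_eq_sliceMap {I K : ℍ[ℝ]} (hI : I ∈ imagSphere) (hK : K ∈ imagSphere) {a b : ℂ}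
    (h : sliceMap I a = sliceMap K b) :
    (I = K ∧ a = b) ∨ (I = -K ∧ a = conj b) ∨ (a = b ∧ a.im = 0) := by
  rw [sliceMap_apply, sliceMap_apply] at h
  have hre : a.re = b.re := by
    rw [← re_slicePoint hI a.re a.im, h, re_slicePoint hK]
  have him : a.im • I = b.im • K := by
    rw [← im_slicePoint hI a.re a.im, h, im_slicePoint hK]
  have hn := congrArg norm him
  rw [norm_smul, norm_smul, hI.2, hK.2, mul_one, mul_one, Real.norm_eq_abs, Real.norm_eq_abs,
    abs_eq_abs] at hn
  by_cases h0 : a.im = 0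
  · have hb : b.im = 0 := by
      rcases hn with hn | hn <;> linarith
    exact Or.inr (Or.inr ⟨Complex.ext hre (h0.trans hb.symm), h0⟩)
  · rcases hn with hn | hn
    · rw [← hn] at him
      exact Or.inl ⟨smul_right_injective _ h0 him, Complex.ext hre hn⟩
    · rw [← neg_eq_iff_eq_neg.2 hn, neg_smul, ← smul_neg] at him
      exact Or.inr (Or.inl ⟨smul_right_injective _ h0 him, Complex.ext (by simpa using hre)
        (by simpa using hn)⟩)

/-! ### Slices of axially symmetric sets -/

section AxiallySymmetric

variable {Ω : Set ℍ[ℝ]}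

theorem mem_complexSlice_iff {J : ℍ[ℝ]} {z : ℂ} : z ∈ complexSlice J Ω ↔ sliceMap J z ∈ Ω := by
  rw [sliceMap_apply]
  rfl

theorem AxiallySymmetric.complexSlice_eq (hΩ : AxiallySymmetric Ω) {I J : ℍ[ℝ]}
    (hI : I ∈ imagSphere) (hJ : J ∈ imagSphere) : complexSlice I Ω = complexSlice J Ω :=
  Subset.antisymm (fun z hz => hΩ I hI z.re z.im hz J hJ) (fun z hz => hΩ J hJ z.re z.im hz I hI)

/-- Conjugating z amounts to replacing J by -J. -/
theorem AxiallySymmetric.conj_mem (hΩ : AxiallySymmetric Ω) {J : ℍ[ℝ]} (hJ : J ∈ imagSphere)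
    {z : ℂ} (hz : z ∈ complexSlice J Ω) : conj z ∈ complexSlice J Ω := by
  rw [mem_complexSlice_iff, ← sliceMap_neg, ← mem_complexSlice_iff,
    hΩ.complexSlice_eq (neg_mem_imagSphere hJ) hJ]
  exact hz

theorem isOpen_complexSlice (hΩ : IsOpen Ω) (J : ℍ[ℝ]) : IsOpen (complexSlice J Ω) := by
  have : complexSlice J Ω = sliceMap J ⁻¹' Ω := by
    ext z
    exact mem_complexSlice_iff
  rw [this]
  exact hΩ.preimage (sliceMap J).continuous

theorem AxialSimplyConnected.isSimplyConnected_complexSlice (hΩ : AxialSimplyConnected Ω)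
    {J : ℍ[ℝ]} (hJ : J ∈ imagSphere) : IsSimplyConnected (complexSlice J Ω) := by
  rw [← (isometry_sliceMap hJ).isEmbedding.isSimplyConnected_image]
  convert hΩ.isSimplyConnected J hJ
  rw [← range_sliceMap, ← image_preimage_eq_inter_range]
  congr 1
  ext z
  exact mem_complexSlice_iff

theorem AxiallySymmetric.complexSlice_ne_univ (hΩ : AxiallySymmetric Ω) (hne : Ω ≠ univ)
    {J : ℍ[ℝ]} (hJ : J ∈ imagSphere) : complexSlice J Ω ≠ univ := by
  intro h
  refine hne (eq_univ_of_forall fun q => ?_)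
  obtain ⟨I, hI, hq⟩ := exists_sliceMap_eq q
  rw [← hq, ← mem_complexSlice_iff, hΩ.complexSlice_eq hI hJ, h]
  trivial

theorem ofReal_mem_complexSlice {J : ℍ[ℝ]} {x : ℝ} :
    (x : ℂ) ∈ complexSlice J Ω ↔ (x : ℍ[ℝ]) ∈ Ω := by
  rw [mem_complexSlice_iff, sliceMap_ofReal]

end AxiallySymmetric

/-! ### Lifting an intrinsic holomorphic function -/

/-- The partial derivatives of `F (x + I y)` in terms of a real derivative. -/
theorem deriv_slicePoint {F : ℍ[ℝ] → ℍ[ℝ]} {I : ℍ[ℝ]} {L : ℂ →L[ℝ] ℍ[ℝ]} {x y : ℝ}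
    (h : HasFDerivAt (fun w => F (sliceMap I w)) L ⟨x, y⟩) :
    deriv (fun s : ℝ => F (slicePoint I s y)) x = L 1 ∧
      deriv (fun t : ℝ => F (slicePoint I x t)) y = L Complex.I := by
  have h1 : HasDerivAt (fun s : ℝ => (⟨s, y⟩ : ℂ)) 1 x := by
    have : (fun s : ℝ => (⟨s, y⟩ : ℂ)) = fun s : ℝ => (s : ℂ) + y * Complex.I :=
      funext fun s => Complex.mk_eq_add_mul_I s y
    rw [this]
    exact Complex.ofRealCLM.hasDerivAt.add_const _
  have h2 : HasDerivAt (fun t : ℝ => (⟨x, t⟩ : ℂ)) Complex.I y := by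
    have : (fun t : ℝ => (⟨x, t⟩ : ℂ)) = fun t : ℝ => (x : ℂ) + t * Complex.I :=
      funext fun t => Complex.mk_eq_add_mul_I x t
    rw [this]
    simpa using (Complex.ofRealCLM.hasDerivAt (x := y) |>.mul_const Complex.I).const_add (x : ℂ)
  have e1 := (h.comp_hasDerivAt x h1).deriv
  have e2 := (h.comp_hasDerivAt y h2).deriv
  simp only [Function.comp_def, sliceMap_apply] at e1 e2
  exact ⟨e1, e2⟩

theorem hasDerivAt_coe (x : ℝ) : HasDerivAt (fun s : ℝ => (s : ℍ[ℝ])) 1 x := by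
  have h := (sliceMap 0).hasFDerivAt.comp_hasDerivAt x (Complex.ofRealCLM.hasDerivAt (x := x))
  have e : (sliceMap 0) ∘ Complex.ofRealCLM = fun s : ℝ => (s : ℍ[ℝ]) :=
    funext fun s => sliceMap_ofReal 0 s
  have e' : (sliceMap 0) (Complex.ofRealCLM 1) = 1 := sliceMap_ofReal 0 1
  rwa [e, e'] at h

theorem sliceDeriv_coe (f : ℍ[ℝ] → ℍ[ℝ]) (x : ℝ) :
    sliceDeriv f x = deriv (fun s : ℝ => f s) x := by
  simp [sliceDeriv]

/-- The extension to `ℍ` of an intrinsic holomorphic function: `x + I y ↦ Re φ + I Im φ`, where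
`φ` is evaluated at `x + i y` and `y ≥ 0`. -/
noncomputable def intrinsicLift (φ : ℂ → ℂ) (q : ℍ[ℝ]) : ℍ[ℝ] :=
  ((φ ⟨q.re, ‖q.im‖⟩).re : ℍ[ℝ]) + ((φ ⟨q.re, ‖q.im‖⟩).im / ‖q.im‖) • q.im

section Lift

variable {φ : ℂ → ℂ} {G : Set ℂ}

theorem im_eq_zero_of_map_conj (hφ : ∀ z ∈ G, φ (conj z) = conj (φ z)) {z : ℂ} (hz : z ∈ G)
    (h0 : z.im = 0) : (φ z).im = 0 := by
  have h := hφ z hz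
  rw [Complex.conj_eq_iff_im.2 h0] at h
  exact Complex.conj_eq_iff_im.1 h.symm

/-- Below the real axis the lift evaluates φ at z̄, and the two sign changes cancel. On the axis its
second term is zero, which is correct because Im φ vanishes there. -/
theorem intrinsicLift_sliceMap (hφ : ∀ z ∈ G, φ (conj z) = conj (φ z)) {I : ℍ[ℝ]}
    (hI : I ∈ imagSphere) {z : ℂ} (hz : z ∈ G) :
    intrinsicLift φ (sliceMap I z) = sliceMap I (φ z) := by
  have hn : ‖z.im • I‖ = |z.im| := by rw [norm_smul, hI.2, mul_one, Real.norm_eq_abs]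
  rw [intrinsicLift, sliceMap_apply, sliceMap_apply, re_slicePoint hI, im_slicePoint hI, hn,
    slicePoint_eq, smul_smul]
  rcases lt_trichotomy z.im 0 with h | h | h
  · have e : (⟨z.re, |z.im|⟩ : ℂ) = conj z := Complex.ext rfl (by simp [abs_of_neg h])
    rw [e, hφ z hz, abs_of_neg h, Complex.conj_re, Complex.conj_im, neg_div_neg_eq,
      div_mul_cancel₀ _ h.ne]
  · have e : (⟨z.re, |z.im|⟩ : ℂ) = z := Complex.ext rfl (by simp [h])
    rw [e, h, im_eq_zero_of_map_conj hφ hz h, mul_zero]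
  · have e : (⟨z.re, |z.im|⟩ : ℂ) = z := Complex.ext rfl (abs_of_pos h)
    rw [e, abs_of_pos h, div_mul_cancel₀ _ h.ne']

/-- At a real point the lift of an intrinsic holomorphic function has a real scalar derivative. -/
theorem hasFDerivAt_intrinsicLift_coe (hG : IsOpen G) (hφ : ∀ z ∈ G, φ (conj z) = conj (φ z))
    {x c : ℝ} (hx : (x : ℂ) ∈ G) (hd : HasDerivAt φ c x) :
    HasFDerivAt (intrinsicLift φ) (c • ContinuousLinearMap.id ℝ ℍ[ℝ]) (x : ℍ[ℝ]) := by
  have hζ : Tendsto (fun q : ℍ[ℝ] => (⟨q.re, ‖q.im‖⟩ : ℂ)) (𝓝 (x : ℍ[ℝ])) (𝓝 (x : ℂ)) := by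
    have h1 : Continuous fun q : ℍ[ℝ] => ((q.re : ℂ) + (‖q.im‖ : ℝ) * Complex.I) := by
      have := Quaternion.continuous_re
      have := Quaternion.continuous_im
      fun_prop
    have h2 := h1.tendsto (x : ℍ[ℝ])
    simp only [← Complex.mk_eq_add_mul_I] at h2
    simpa [← Complex.ofReal_def] using h2
  have hlift : ∀ q : ℍ[ℝ], (⟨q.re, ‖q.im‖⟩ : ℂ) ∈ G → ∃ I ∈ imagSphere,
      sliceMap I ⟨q.re, ‖q.im‖⟩ = q ∧ intrinsicLift φ q = sliceMap I (φ ⟨q.re, ‖q.im‖⟩) := by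
    intro q hq
    obtain ⟨I, hI, h⟩ := exists_sliceMap_eq q
    exact ⟨I, hI, h, by rw [← intrinsicLift_sliceMap hφ hI hq, h]⟩
  have hx0 : intrinsicLift φ (x : ℍ[ℝ]) = ((φ x).re : ℝ) := by
    rw [← sliceMap_ofReal unitI x, intrinsicLift_sliceMap hφ unitI_mem_imagSphere hx,
      ← sliceMap_ofReal unitI]
    congr 1
    exact Complex.ext rfl (im_eq_zero_of_map_conj hφ hx (Complex.ofReal_im x))
  have hφx : φ x = ((φ x).re : ℝ) :=
    Complex.ext rfl (im_eq_zero_of_map_conj hφ hx (Complex.ofReal_im x))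
  have ho := (hasDerivAt_iff_isLittleO.1 hd).comp_tendsto hζ
  rw [hasFDerivAt_iff_isLittleO]
  have hev : ∀ᶠ q in 𝓝 (x : ℍ[ℝ]), (⟨q.re, ‖q.im‖⟩ : ℂ) ∈ G := hζ (hG.mem_nhds hx)
  -- Each q lies in some slice, whose isometry identifies the remainder at q with that of φ at re q
  -- + i‖im q‖; the estimate is thus uniform in I. That c is real lets it commute with `sliceMap I`.
  refine IsLittleO.of_norm_norm ((ho.norm_norm).congr' ?_ ?_)
  · filter_upwards [hev] with q hq
    obtain ⟨I, hI, h1, h2⟩ := hlift q hq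
    have e : φ ⟨q.re, ‖q.im‖⟩ - φ x - ((⟨q.re, ‖q.im‖⟩ : ℂ) - x) • (c : ℂ) =
        φ ⟨q.re, ‖q.im‖⟩ - ((φ x).re : ℝ) - c • ((⟨q.re, ‖q.im‖⟩ : ℂ) - (x : ℝ)) := by
      rw [← hφx, smul_eq_mul, mul_comm, Complex.real_smul]
    rw [h2, hx0, Function.comp_apply, e, ← norm_sliceMap hI, map_sub, map_sub, map_smul, map_sub,
      h1, sliceMap_ofReal, sliceMap_ofReal]
    rfl
  · filter_upwards [hev] with q hq
    obtain ⟨I, hI, h1, h2⟩ := hlift q hq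
    rw [← norm_sliceMap hI, Function.comp_apply, map_sub, h1, sliceMap_ofReal]

theorem differentiableAt_intrinsicLift {q : ℍ[ℝ]} (h0 : q.im ≠ 0)
    (hφ : DifferentiableAt ℂ φ ⟨q.re, ‖q.im‖⟩) : DifferentiableAt ℝ (intrinsicLift φ) q := by
  have hre : Differentiable ℝ fun q : ℍ[ℝ] => q.re := by
    have : (fun q : ℍ[ℝ] => q.re) = innerSL ℝ (1 : ℍ[ℝ]) := by
      ext q
      simp [Quaternion.inner_def]
    rw [this]
    exact (innerSL ℝ (1 : ℍ[ℝ])).differentiable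
  have hcoe : Differentiable ℝ fun s : ℝ => (s : ℍ[ℝ]) := fun s =>
    (hasDerivAt_coe s).differentiableAt
  have him : Differentiable ℝ fun q : ℍ[ℝ] => q.im := by
    have : (fun q : ℍ[ℝ] => q.im) = fun q => q - (q.re : ℍ[ℝ]) :=
      funext fun q => (Quaternion.sub_re_self q).symm
    rw [this]
    exact differentiable_id.sub (hcoe.comp hre)
  have hn : DifferentiableAt ℝ (fun q : ℍ[ℝ] => ‖q.im‖) q := (him q).norm ℝ h0
  have hζ : DifferentiableAt ℝ (fun q : ℍ[ℝ] => (⟨q.re, ‖q.im‖⟩ : ℂ)) q := by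
    simp only [Complex.mk_eq_add_mul_I]
    exact (Complex.ofRealCLM.differentiableAt.comp q (hre q)).add
      ((Complex.ofRealCLM.differentiableAt.comp q hn).mul_const _)
  have hψ := (hφ.restrictScalars ℝ).comp q hζ
  have hdiv : DifferentiableAt ℝ (fun q : ℍ[ℝ] => (φ ⟨q.re, ‖q.im‖⟩).im / ‖q.im‖) q :=
    have him' : DifferentiableAt ℝ (fun q : ℍ[ℝ] => (φ ⟨q.re, ‖q.im‖⟩).im) q :=
      Complex.imCLM.differentiableAt.comp q hψ
    by simpa only [div_eq_mul_inv] using him'.fun_mul (hn.fun_inv (norm_ne_zero_iff.2 h0))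
  exact (hcoe.differentiableAt.comp q (Complex.reCLM.differentiableAt.comp q hψ)).add
    (hdiv.smul (him q))

end Lift

/-! ### Existence: the lift of the Riemann map -/

section Existence

variable {Ω : Set ℍ[ℝ]} {φ : ℂ → ℂ} {x₀ : ℝ} {J : ℍ[ℝ]}

theorem intrinsicLift_slicePoint (hΩ : AxiallySymmetric Ω) (hJ : J ∈ imagSphere)
    (hφ : IsIntrinsicRiemannMap φ (complexSlice J Ω) x₀) {I : ℍ[ℝ]} (hI : I ∈ imagSphere) {z : ℂ}
    (hz : sliceMap I z ∈ Ω) : intrinsicLift φ (sliceMap I z) = sliceMap I (φ z) :=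
  intrinsicLift_sliceMap hφ.map_conj hI
    (hΩ.complexSlice_eq hI hJ ▸ mem_complexSlice_iff.2 hz)

/-- Near x, φ equals conj ∘ φ ∘ conj, so its derivative at x equals its own conjugate. -/
theorem hasDerivAt_ofReal_of_isIntrinsicRiemannMap (hΩ : IsOpen Ω)
    (hφ : IsIntrinsicRiemannMap φ (complexSlice J Ω) x₀) {x : ℝ} (hx : (x : ℍ[ℝ]) ∈ Ω) :
    HasDerivAt φ ((deriv φ x).re : ℝ) x := by
  have hG := isOpen_complexSlice hΩ J
  have hx' : (x : ℂ) ∈ complexSlice J Ω := ofReal_mem_complexSlice.2 hx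
  have hd := (hφ.differentiableOn.differentiableAt (hG.mem_nhds hx')).hasDerivAt
  have hc : HasDerivAt (conj ∘ φ ∘ conj) (conj (deriv φ x)) x := by
    simpa using hd.conj_conj
  have heq : conj ∘ φ ∘ conj =ᶠ[𝓝 (x : ℂ)] φ := by
    filter_upwards [hG.mem_nhds hx'] with z hz
    simp [hφ.map_conj z hz]
  have h := (hc.congr_of_eventuallyEq heq.symm).unique hd
  rw [Complex.conj_eq_iff_re.1 h]
  exact hd

theorem sliceRegularOn_intrinsicLift (hΩ : IsOpen Ω) (hs : AxiallySymmetric Ω)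
    (hJ : J ∈ imagSphere) (hφ : IsIntrinsicRiemannMap φ (complexSlice J Ω) x₀) :
    SliceRegularOn (intrinsicLift φ) Ω := by
  have hG := isOpen_complexSlice hΩ J
  refine ⟨hΩ, fun q hq => DifferentiableAt.differentiableWithinAt ?_, fun I hI x y hxy => ?_⟩
  · obtain ⟨I, hI, hqI⟩ := exists_sliceMap_eq q
    have hz : (⟨q.re, ‖q.im‖⟩ : ℂ) ∈ complexSlice J Ω := by
      rw [← hs.complexSlice_eq hI hJ, mem_complexSlice_iff, hqI]
      exact hq
    by_cases h0 : q.im = 0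
    · have hqr : q = (q.re : ℝ) := by rw [← Quaternion.sub_im_self, h0, sub_zero]
      rw [hqr] at hq ⊢
      exact (hasFDerivAt_intrinsicLift_coe hG hφ.map_conj (ofReal_mem_complexSlice.2 hq)
        (hasDerivAt_ofReal_of_isIntrinsicRiemannMap hΩ hφ hq)).differentiableAt
    · exact differentiableAt_intrinsicLift h0 (hφ.differentiableOn.differentiableAt (hG.mem_nhds hz))
  · have hz : (⟨x, y⟩ : ℂ) ∈ complexSlice J Ω := by
      rw [← hs.complexSlice_eq hI hJ]
      exact hxy
    have hd := (hφ.differentiableOn.differentiableAt (hG.mem_nhds hz)).hasDerivAt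
    have heq : (fun w => intrinsicLift φ (sliceMap I w)) =ᶠ[𝓝 (⟨x, y⟩ : ℂ)]
        fun w => sliceMap I (φ w) := by
      filter_upwards [hG.mem_nhds hz] with w hw
      exact intrinsicLift_sliceMap hφ.map_conj hI hw
    have hL := ((sliceMap I).hasFDerivAt.comp _
      (hd.hasFDerivAt.restrictScalars ℝ)).congr_of_eventuallyEq heq
    obtain ⟨h1, h2⟩ := deriv_slicePoint hL
    rw [dbar, h1, h2]
    simp [sliceMap_I_mul hI, ← mul_assoc, mul_self_of_mem_imagSphere hI]

theorem bijOn_intrinsicLift (hs : AxiallySymmetric Ω)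
    (hJ : J ∈ imagSphere) (hφ : IsIntrinsicRiemannMap φ (complexSlice J Ω) x₀) :
    BijOn (intrinsicLift φ) Ω (ball 0 1) := by
  have hmem : ∀ q ∈ Ω, ∃ I ∈ imagSphere, ∃ z ∈ complexSlice J Ω, sliceMap I z = q := by
    intro q hq
    obtain ⟨I, hI, h⟩ := exists_sliceMap_eq q
    refine ⟨I, hI, _, ?_, h⟩
    rw [← hs.complexSlice_eq hI hJ, mem_complexSlice_iff, h]
    exact hq
  refine ⟨fun q hq => ?_, fun q hq q' hq' h => ?_, fun w hw => ?_⟩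
  · obtain ⟨I, hI, z, hz, rfl⟩ := hmem q hq
    rw [intrinsicLift_sliceMap hφ.map_conj hI hz, mem_ball_zero_iff, norm_sliceMap hI]
    exact mem_ball_zero_iff.1 (hφ.bijOn.mapsTo hz)
  · obtain ⟨I, hI, z, hz, rfl⟩ := hmem q hq
    obtain ⟨K, hK, w, hw, rfl⟩ := hmem q' hq'
    rw [intrinsicLift_sliceMap hφ.map_conj hI hz, intrinsicLift_sliceMap hφ.map_conj hK hw] at h
    rcases sliceMap_eq_sliceMap hI hK h with ⟨rfl, e⟩ | ⟨rfl, e⟩ | ⟨e, h0⟩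
    · rw [hφ.bijOn.injOn hz hw e]
    · rw [← hφ.map_conj w hw] at e
      rw [hφ.bijOn.injOn hz (hφ.conj_mem w hw) e, sliceMap_neg, Complex.conj_conj]
    -- Images in different slices meet only at a real value. By symmetry and injectivity φ is real
    -- only at real points, where the slice is irrelevant.
    · obtain rfl := hφ.bijOn.injOn hz hw e
      have h1 : conj z = z := hφ.bijOn.injOn (hφ.conj_mem z hz) hz (by
        rw [hφ.map_conj z hz]
        exact Complex.conj_eq_iff_im.2 h0)
      rw [← Complex.conj_eq_iff_re.1 h1, sliceMap_ofReal, sliceMap_ofReal]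
  · obtain ⟨I, hI, h⟩ := exists_sliceMap_eq w
    obtain ⟨z, hz, hzw⟩ := hφ.bijOn.surjOn (show (⟨w.re, ‖w.im‖⟩ : ℂ) ∈ ball 0 1 by
      rw [mem_ball_zero_iff, ← norm_sliceMap hI, h]
      exact mem_ball_zero_iff.1 hw)
    refine ⟨sliceMap I z, ?_, by rw [intrinsicLift_sliceMap hφ.map_conj hI hz, hzw, h]⟩
    rw [← mem_complexSlice_iff, hs.complexSlice_eq hI hJ]
    exact hz

theorem isNormalizedRiemannMap_intrinsicLift (hΩ : IsOpen Ω) (hs : AxiallySymmetric Ω)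
    (hx₀ : (x₀ : ℍ[ℝ]) ∈ Ω) (hJ : J ∈ imagSphere)
    (hφ : IsIntrinsicRiemannMap φ (complexSlice J Ω) x₀) :
    IsNormalizedRiemannMap (intrinsicLift φ) Ω x₀ := by
  have hx' : (x₀ : ℂ) ∈ complexSlice J Ω := ofReal_mem_complexSlice.2 hx₀
  refine ⟨⟨sliceRegularOn_intrinsicLift hΩ hs hJ hφ, fun I hI q hq => ?_⟩,
    bijOn_intrinsicLift hs hJ hφ, ?_, ?_⟩
  · obtain ⟨hqΩ, hqI⟩ := hq
    rw [← range_sliceMap] at hqI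
    obtain ⟨z, rfl⟩ := hqI
    rw [intrinsicLift_slicePoint hs hJ hφ hI hqΩ]
    exact sliceMap_mem_slicePlane I _
  · rw [← sliceMap_ofReal J, intrinsicLift_sliceMap hφ.map_conj hJ hx', hφ.map_base, map_zero]
  · obtain ⟨c, hc, hd⟩ := hφ.deriv_pos
    have h1 := hasDerivAt_ofReal_of_isIntrinsicRiemannMap hΩ hφ hx₀
    have h2 := (hasFDerivAt_intrinsicLift_coe (isOpen_complexSlice hΩ J) hφ.map_conj hx'
      h1).comp_hasDerivAt x₀ (hasDerivAt_coe x₀)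
    refine ⟨c, hc, ?_⟩
    rw [sliceDeriv_coe]
    refine h2.deriv.trans ?_
    rw [hd, Complex.ofReal_re, ← mul_one (c : ℍ[ℝ]), Quaternion.coe_mul_eq_smul]
    rfl

/-- By the symmetry of φ, F(x ∓ Jy) are conjugate in ℂ_J, so the two brackets of the formula reduce
to Re φ and Im φ, and J disappears. -/
theorem intrinsicLift_eq_sliceExt (hs : AxiallySymmetric Ω)
    (hJ : J ∈ imagSphere) (hφ : IsIntrinsicRiemannMap φ (complexSlice J Ω) x₀) {I : ℍ[ℝ]}
    (hI : I ∈ imagSphere) {x y : ℝ} (hxy : slicePoint I x y ∈ Ω) :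
    intrinsicLift φ (slicePoint I x y) = sliceExt J (onSlice J φ) I x y := by
  have hz : (⟨x, y⟩ : ℂ) ∈ complexSlice J Ω := by
    rw [← hs.complexSlice_eq hI hJ]
    exact hxy
  have h1 : φ ⟨x, -y⟩ = conj (φ ⟨x, y⟩) := hφ.map_conj _ hz
  have h2 := intrinsicLift_sliceMap hφ.map_conj hI hz
  rw [sliceMap_apply, sliceMap_apply] at h2
  rw [h2, sliceExt, onSlice, onSlice, h1]
  generalize φ ⟨x, y⟩ = w
  simp only [slicePoint_eq, Complex.conj_re, Complex.conj_im]
  have e1 : (1 / 2 : ℝ) • ((w.re : ℍ[ℝ]) + w.im • J + ((w.re : ℍ[ℝ]) + -w.im • J)) = w.re := by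
    module
  have e2 : (w.re : ℍ[ℝ]) + -w.im • J - ((w.re : ℍ[ℝ]) + w.im • J) = (-2 * w.im) • J := by
    module
  rw [e1, e2, mul_smul_comm, mul_smul_comm, mul_smul_comm, mul_self_of_mem_imagSphere hJ, mul_neg,
    mul_one]
  module

end Existence

/-! ### Uniqueness: restriction to a slice -/

section Uniqueness

variable {Ω : Set ℍ[ℝ]} {g : ℍ[ℝ] → ℍ[ℝ]} {x₀ : ℝ}

/-- A slice regular function is holomorphic in each slice, after projection to that slice. -/
theorem SliceRegularOn.differentiableOn_sliceProj (hg : SliceRegularOn g Ω) {I : ℍ[ℝ]}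
    (hI : I ∈ imagSphere) :
    DifferentiableOn ℂ (fun z => sliceProj I (g (sliceMap I z))) (complexSlice I Ω) := by
  rintro ⟨x, y⟩ hz
  have hd : DifferentiableAt ℝ g (sliceMap I ⟨x, y⟩) :=
    hg.differentiableOn.differentiableAt (hg.isOpen.mem_nhds (mem_complexSlice_iff.1 hz))
  have hL := hd.hasFDerivAt.comp (⟨x, y⟩ : ℂ) (sliceMap I).hasFDerivAt
  obtain ⟨h1, h2⟩ := deriv_slicePoint hL
  have h3 := hg.dbar_eq_zero I hI x y hz
  rw [dbar, h1, h2] at h3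
  set L := (fderiv ℝ g (sliceMap I ⟨x, y⟩)).comp (sliceMap I)
  -- Left multiplication of ∂ₓ + I∂ᵧ = 0 by I.
  have h4 : L Complex.I = I * L 1 := by
    have h5 := (smul_eq_zero.1 h3).resolve_left (by norm_num)
    have h6 := congrArg (I * ·) h5
    simp only [mul_add, ← mul_assoc, mul_self_of_mem_imagSphere hI, mul_zero, neg_mul,
      one_mul] at h6
    exact (sub_eq_zero.1 (by rw [sub_eq_add_neg]; exact h6)).symm
  have hP := (sliceProj I).hasFDerivAt.comp (⟨x, y⟩ : ℂ) hL
  refine DifferentiableAt.differentiableWithinAt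
    (differentiableAt_complex_iff_differentiableAt_real.2 ⟨hP.differentiableAt, ?_⟩)
  have e : fderiv ℝ (fun z => sliceProj I (g (sliceMap I z))) ⟨x, y⟩ = (sliceProj I).comp L :=
    hP.fderiv
  rw [e]
  change sliceProj I (L Complex.I) = Complex.I * sliceProj I (L 1)
  rw [h4, sliceProj_mul hI]

theorem QuaternionicIntrinsicOn.apply_coe (hg : QuaternionicIntrinsicOn g Ω) {x : ℝ}
    (hx : (x : ℍ[ℝ]) ∈ Ω) : g x = (g x).re :=
  eq_coe_re_of_forall_mem_slicePlane fun I hI =>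
    hg.mapsTo I hI ⟨hx, x, 0, (slicePoint_zero I x).symm⟩

/-- A quaternionic intrinsic function is given by the same holomorphic function on all slices. -/
theorem QuaternionicIntrinsicOn.apply_sliceMap (hΩ : AxialSimplyConnected Ω)
    (hg : QuaternionicIntrinsicOn g Ω) (hx₀ : (x₀ : ℍ[ℝ]) ∈ Ω) {I J : ℍ[ℝ]} (hI : I ∈ imagSphere)
    (hJ : J ∈ imagSphere) {z : ℂ} (hz : z ∈ complexSlice J Ω) :
    g (sliceMap I z) = sliceMap I (sliceProj J (g (sliceMap J z))) := by
  have hs := hΩ.axiallySymmetric.complexSlice_eq hI hJ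
  have hG := isOpen_complexSlice hΩ.isOpen J
  have hgI := hg.sliceRegularOn.differentiableOn_sliceProj hI
  rw [hs] at hgI
  have hgJ := hg.sliceRegularOn.differentiableOn_sliceProj hJ
  have hreal : ∀ x : ℝ, (x : ℍ[ℝ]) ∈ Ω →
      sliceProj I (g (sliceMap I x)) = sliceProj J (g (sliceMap J x)) := by
    intro x hx
    rw [sliceMap_ofReal, sliceMap_ofReal, hg.apply_coe hx, sliceProj_coe hI, sliceProj_coe hJ]
  have hT : Tendsto (fun x : ℝ => (x : ℂ)) (𝓝[≠] x₀) (𝓝[≠] (x₀ : ℂ)) :=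
    tendsto_nhdsWithin_of_tendsto_nhds_of_eventually_within _
      (Complex.continuous_ofReal.continuousAt.tendsto.mono_left nhdsWithin_le_nhds)
      (by filter_upwards [self_mem_nhdsWithin] with x hx using
        fun h => hx (Complex.ofReal_injective h))
  have hev : ∀ᶠ x in 𝓝[≠] x₀,
      sliceProj I (g (sliceMap I (x : ℝ))) = sliceProj J (g (sliceMap J (x : ℝ))) := by
    have : ∀ᶠ x : ℝ in 𝓝 x₀, (x : ℍ[ℝ]) ∈ Ω :=
      (hasDerivAt_coe x₀).continuousAt (hΩ.isOpen.mem_nhds hx₀)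
    filter_upwards [nhdsWithin_le_nhds this] with x hx using hreal x hx
  -- Identity theorem: the two slice functions agree at the real points near x₀, which accumulate
  -- there.
  have h := (hgI.analyticOnNhd hG).eqOn_of_preconnected_of_frequently_eq (hgJ.analyticOnNhd hG)
    (hΩ.isSimplyConnected_complexSlice hJ).isPathConnected.isConnected.isPreconnected
    (ofReal_mem_complexSlice.2 hx₀) (hT.frequently hev.frequently) hz
  simp only at h
  rw [← h, sliceMap_sliceProj hI]
  refine hg.mapsTo I hI ⟨?_, sliceMap_mem_slicePlane I z⟩
  rw [← mem_complexSlice_iff, hs]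
  exact hz

/-- The restriction to a slice of a normalized Riemann map. -/
theorem IsNormalizedRiemannMap.isIntrinsicRiemannMap (hΩ : AxialSimplyConnected Ω)
    (hg : IsNormalizedRiemannMap g Ω x₀) (hx₀ : (x₀ : ℍ[ℝ]) ∈ Ω) {J : ℍ[ℝ]}
    (hJ : J ∈ imagSphere) :
    IsIntrinsicRiemannMap (fun z => sliceProj J (g (sliceMap J z))) (complexSlice J Ω) x₀ := by
  have hs := hΩ.axiallySymmetric
  have hG := isOpen_complexSlice hΩ.isOpen J
  have hx' : (x₀ : ℂ) ∈ complexSlice J Ω := ofReal_mem_complexSlice.2 hx₀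
  have hgd := hg.intrinsic.sliceRegularOn.differentiableOn_sliceProj hJ
  have hrep : ∀ I ∈ imagSphere, ∀ z ∈ complexSlice J Ω,
      g (sliceMap I z) = sliceMap I (sliceProj J (g (sliceMap J z))) := fun I hI z hz =>
    hg.intrinsic.apply_sliceMap hΩ hx₀ hI hJ hz
  have hconj : ∀ z ∈ complexSlice J Ω, conj z ∈ complexSlice J Ω := fun z hz => hs.conj_mem hJ hz
  have hmc : ∀ z ∈ complexSlice J Ω, sliceProj J (g (sliceMap J (conj z))) =
      conj (sliceProj J (g (sliceMap J z))) := by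
    intro z hz
    rw [← sliceMap_neg, hrep _ (neg_mem_imagSphere hJ) z hz, sliceMap_neg, sliceProj_sliceMap hJ]
  refine ⟨hgd, ⟨fun z hz => ?_, fun z hz w hw h => ?_, fun a ha => ?_⟩, ?_, ?_, hconj, hmc⟩
  · rw [mem_ball_zero_iff, ← norm_sliceMap hJ, ← hrep J hJ z hz]
    exact mem_ball_zero_iff.1 (hg.bijOn.mapsTo (mem_complexSlice_iff.1 hz))
  · refine (isometry_sliceMap hJ).injective (hg.bijOn.injOn (mem_complexSlice_iff.1 hz)
      (mem_complexSlice_iff.1 hw) ?_)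
    rw [hrep J hJ z hz, hrep J hJ w hw]
    exact congrArg _ h
  · obtain ⟨q, hq, hqa⟩ := hg.bijOn.surjOn (show sliceMap J a ∈ ball 0 1 by
      rw [mem_ball_zero_iff, norm_sliceMap hJ]
      exact mem_ball_zero_iff.1 ha)
    obtain ⟨I, hI, h⟩ := exists_sliceMap_eq q
    have hz : (⟨q.re, ‖q.im‖⟩ : ℂ) ∈ complexSlice J Ω := by
      rw [← hs.complexSlice_eq hI hJ, mem_complexSlice_iff, h]
      exact hq
    rw [← h, hrep I hI _ hz] at hqa
    -- The preimage may lie in a slice other than ℂ_J. Then I = -J, and z̄ is the preimage sought,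
    -- or the value is real and z itself works.
    rcases sliceMap_eq_sliceMap hI hJ hqa with ⟨-, h'⟩ | ⟨-, h'⟩ | ⟨h', -⟩
    · exact ⟨_, hz, h'⟩
    · exact ⟨_, hconj _ hz, by simp only [hmc _ hz, h', Complex.conj_conj]⟩
    · exact ⟨_, hz, h'⟩
  · simp only [sliceMap_ofReal, hg.map_base, map_zero]
  · obtain ⟨c, hc, hcd⟩ := hg.sliceDeriv_pos
    refine ⟨c, hc, ?_⟩
    have hd : DifferentiableAt ℝ g (x₀ : ℍ[ℝ]) :=
      hg.intrinsic.sliceRegularOn.differentiableOn.differentiableAt (hΩ.isOpen.mem_nhds hx₀)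
    have h1 := (hd.hasFDerivAt.comp_hasDerivAt x₀ (hasDerivAt_coe x₀)).differentiableAt.hasDerivAt
    have h2 := (sliceProj J).hasFDerivAt.comp_hasDerivAt x₀ h1
    have e : deriv (g ∘ fun s : ℝ => (s : ℍ[ℝ])) x₀ = c := by
      rw [← hcd, sliceDeriv_coe]
      rfl
    rw [e, sliceProj_coe hJ] at h2
    -- The complex derivative is read off along the real axis, where it is the projection of the
    -- slice derivative c.
    have h3 := (hgd.differentiableAt (hG.mem_nhds hx')).hasDerivAt.comp_ofReal
    simp only [sliceMap_ofReal] at h3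
    exact h3.unique h2

theorem IsNormalizedRiemannMap.eqOn_intrinsicLift (hΩ : AxialSimplyConnected Ω)
    (hg : IsNormalizedRiemannMap g Ω x₀) (hx₀ : (x₀ : ℍ[ℝ]) ∈ Ω) {J : ℍ[ℝ]}
    (hJ : J ∈ imagSphere) {φ : ℂ → ℂ} (hφ : IsIntrinsicRiemannMap φ (complexSlice J Ω) x₀) :
    EqOn g (intrinsicLift φ) Ω := by
  intro q hq
  obtain ⟨I, hI, h⟩ := exists_sliceMap_eq q
  have hz : (⟨q.re, ‖q.im‖⟩ : ℂ) ∈ complexSlice J Ω := by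
    rw [← hΩ.axiallySymmetric.complexSlice_eq hI hJ, mem_complexSlice_iff, h]
    exact hq
  have hψ := hg.isIntrinsicRiemannMap hΩ hx₀ hJ
  have heq := eqOn_of_bijOn_ball (isOpen_complexSlice hΩ.isOpen J)
    (ofReal_mem_complexSlice.2 hx₀) hφ.differentiableOn hφ.bijOn hφ.map_base hψ.differentiableOn
    hψ.bijOn hψ.map_base hφ.deriv_pos hψ.deriv_pos hz
  simp only at heq
  rw [← h, intrinsicLift_sliceMap hφ.map_conj hI hz,
    hg.intrinsic.apply_sliceMap hΩ hx₀ hI hJ hz, heq]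

end Uniqueness

/-! ### Conclusion -/

theorem AxialSimplyConnected.exists_isIntrinsicRiemannMap {Ω : Set ℍ[ℝ]}
    (hΩ : AxialSimplyConnected Ω) (hne : Ω ≠ univ) {x₀ : ℝ} (hx₀ : (x₀ : ℍ[ℝ]) ∈ Ω) {J : ℍ[ℝ]}
    (hJ : J ∈ imagSphere) : ∃ φ, IsIntrinsicRiemannMap φ (complexSlice J Ω) x₀ := by
  have hG := isOpen_complexSlice hΩ.isOpen J
  have hx' : (x₀ : ℂ) ∈ complexSlice J Ω := ofReal_mem_complexSlice.2 hx₀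
  have hconj : ∀ z ∈ complexSlice J Ω, conj z ∈ complexSlice J Ω :=
    fun z hz => hΩ.axiallySymmetric.conj_mem hJ hz
  obtain ⟨φ, hφ, hφb, hφ0, hφ'⟩ := exists_bijOn_ball hG (hΩ.isSimplyConnected_complexSlice hJ)
    (hΩ.axiallySymmetric.complexSlice_ne_univ hne hJ) hx'
  exact ⟨φ, hφ, hφb, hφ0, hφ', hconj, map_conj_of_bijOn_ball hG hx' hφ hφb hφ0 hφ' hconj⟩

end SliceRiemann

theorem mainTheorem2 (Ω : Set ℍ[ℝ]) (hΩ : SliceRiemann.AxialSimplyConnected Ω)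
    (hne : Ω ≠ Set.univ) (x₀ : ℝ) (hx₀ : (x₀ : ℍ[ℝ]) ∈ Ω) :
    ∃ f : ℍ[ℝ] → ℍ[ℝ],
      SliceRiemann.IsNormalizedRiemannMap f Ω x₀ ∧
      (∀ g : ℍ[ℝ] → ℍ[ℝ], SliceRiemann.IsNormalizedRiemannMap g Ω x₀ → Set.EqOn g f Ω) ∧
      ∀ J ∈ SliceRiemann.imagSphere, ∃ φ : ℂ → ℂ,
        SliceRiemann.IsIntrinsicRiemannMap φ (SliceRiemann.complexSlice J Ω) x₀ ∧
        ∀ I ∈ SliceRiemann.imagSphere, ∀ x y : ℝ, SliceRiemann.slicePoint I x y ∈ Ω →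
          f (SliceRiemann.slicePoint I x y) =
            SliceRiemann.sliceExt J (SliceRiemann.onSlice J φ) I x y := by
  have hs := hΩ.axiallySymmetric
  have hK := SliceRiemann.unitI_mem_imagSphere
  -- One φ, built on the slice of `unitI`, serves every J, since `complexSlice J Ω` does not depend
  -- on J.
  obtain ⟨φ, hφ⟩ := hΩ.exists_isIntrinsicRiemannMap hne hx₀ hK
  refine ⟨SliceRiemann.intrinsicLift φ,
    SliceRiemann.isNormalizedRiemannMap_intrinsicLift hΩ.isOpen hs hx₀ hK hφ,
    fun g hg => hg.eqOn_intrinsicLift hΩ hx₀ hK hφ, fun J hJ => ⟨φ, ?_, ?_⟩⟩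
  · rwa [hs.complexSlice_eq hJ hK]
  · rw [hs.complexSlice_eq hK hJ] at hφ
    exact fun I hI x y hxy => SliceRiemann.intrinsicLift_eq_sliceExt hs hJ hφ hI hxy
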